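/- Let $n\ge 0$ and let $W$ be the Weyl algebra, i.e. the complex vector space $\mathbb C[p_1,q_1,\dots,p_n,q_n]$ with the Moyal product $a*b=m\big(\exp\big(\tfrac12\sum_{i}(\partial_{p_i}\otimes\partial_{q_i}-\partial_{q_i}\otimes\partial_{p_i})\big)(a\otimes b)\big)$, where $m$ is the commutative multiplication of polynomials. Let $V=\mathrm{span}(p_1,q_1,\dots,p_n,q_n)\subset W$, let $Z_1,\dots,Z_{2n}$ be the basis $p_1,q_1,\dots,p_n,q_n$ of $V$ with dual basis $Z_1^*,\dots,Z_{2n}^*$, and let $\Lambda=\bigoplus_k\Lambda^k$ be the exterior algebra of $V$. Let $M$ be a $W$-bimodule (with the same action of $\mathbb C$ on both sides). The normalized Hochschild complex $\mathcal C(M)$ has as $k$-cochains the $\mathbb C$-multilinear maps $C:W^k\to M$ that vanish when one argument is a scalar, i.e. $\mathcal C^k(M)=\mathcal L((W/\mathbb C)^{\otimes k},M)$, with differential $$(dC)(a_0,\dots,a_k)=a_0C(a_1,\dots,a_k)+\sum_{i=0}^{k-1}(-1)^{i+1}C(a_0,\dots,a_i*a_{i+1},\dots,a_k)+(-1)^{k+1}C(a_0,\dots,a_{k-1})a_k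 .$$ The Koszul complex $K(M)$ has $K^k(M)=\mathcal L(\Lambda^k,M)=M\otimes\Lambda^{k*}$ and differential $\Delta_k=\sum_{i=1}^{2n}\mathrm{ad}\,Z_i\otimes\mu_{Z_i^*}$, where $\mathrm{ad}\,Z_i(m)=Z_im-mZ_i$ and $\mu_{Z_i^*}(\Omega)=Z_i^*\wedge\Omega$, that is $$(\Delta_k c)(v_0\wedge\dots\wedge v_k)=\sum_{j=0}^k(-1)^j\big(v_j\,c(v_0\wedge\dots\widehat{v_j}\dots\wedge v_k)-c(v_0\wedge\dots\widehat{v_j}\dots\wedge v_k)\,v_j\big).$$ The restriction of $C\in\mathcal C^k(M)$ to $\Lambda^k$ is $R(C)(v_1\wedge\dots\wedge v_k)=\sum_{\sigma\in\Sigma_k}\epsilon(\sigma)\,C(v_{\sigma(1)},\dots,v_{\sigma(k)})$. Then: (1) $R:\mathcal C(M)\to K(M)$ is a morphism of complexes ($\Delta\circ R=R\circ d$) and induces an isomorphism in cohomology in every degree. (2) For every $k\ge 0$ and every $c\in K^k(M)$ with $\Delta_k c=0$ there is $C\in\mathcal C^k(M)$ with $dC=0$ and $R(C)=c$. If $C'\in\mathcal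 C^k(M)$ is another Hochschild cocycle with $R(C')=c$, then $C-C'$ is a Hochschild coboundary, i.e. $C-C'\in d(\mathcal C^{k-1}(M))$ (and $C=C'$ if $k=0$). -/

import Mathlib

set_option linter.unusedSectionVars false

open scoped TensorProduct

noncomputable section

namespace Weyl

section LocalExp

variable {E F : Type*} [AddCommMonoid E] [Module ℂ E] [AddCommMonoid F] [Module ℂ F]

/-- A linear endomorphism all of whose orbits terminate at zero. -/
def LocNil (f : Module.End ℂ E) : Prop := ∀ x, ∃ N : ℕ, (f ^ N) x = 0

lemma pow_zero_of_le {f : Module.End ℂ E} {x : E} {N M : ℕ} (h : (f ^ N) x = 0) (hM : N ≤ M) :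
    (f ^ M) x = 0 := by
  obtain ⟨k, rfl⟩ := Nat.exists_eq_add_of_le' hM
  rw [pow_add, Module.End.mul_apply, h, map_zero]

lemma LocNil.support_finite {f : Module.End ℂ E} (hf : LocNil f) (x : E) :
    (Function.support fun k : ℕ => ((k.factorial : ℂ)⁻¹) • (f ^ k) x).Finite := by
  obtain ⟨N, hN⟩ := hf x
  refine (Finset.range N).finite_toSet.subset fun k hk => ?_
  by_contra h
  refine hk ?_
  simp only [Finset.coe_range, Set.mem_Iio, not_lt] at h
  simp [pow_zero_of_le hN h]

/-- The exponential series `∑ fᵏ / k!` of a locally nilpotent endomorphism. -/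
def locExp (f : Module.End ℂ E) (hf : LocNil f) : Module.End ℂ E where
  toFun x := ∑ᶠ k : ℕ, ((k.factorial : ℂ)⁻¹) • (f ^ k) x
  map_add' x y := by
    rw [← finsum_add_distrib (hf.support_finite x) (hf.support_finite y)]
    simp
  map_smul' c x := by
    rw [RingHom.id_apply, smul_finsum' c (hf.support_finite x)]
    simp [smul_comm c]

lemma locExp_apply (f : Module.End ℂ E) (hf : LocNil f) (x : E) :
    locExp f hf x = ∑ᶠ k : ℕ, ((k.factorial : ℂ)⁻¹) • (f ^ k) x := rfl

lemma locExp_eq_sum (f : Module.End ℂ E) (hf : LocNil f) (x : E) {N : ℕ} (hN : (f ^ N) x = 0) :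
    locExp f hf x = ∑ k ∈ Finset.range N, ((k.factorial : ℂ)⁻¹) • (f ^ k) x := by
  rw [locExp_apply]
  refine finsum_eq_sum_of_support_subset _ fun k hk => ?_
  by_contra h
  refine hk ?_
  simp only [Finset.coe_range, Set.mem_Iio, not_lt] at h
  simp [pow_zero_of_le hN h]

lemma locExp_congr {f g : Module.End ℂ E} (h : f = g) (hf : LocNil f) (hg : LocNil g) (x : E) :
    locExp f hf x = locExp g hg x := by subst h; rfl

lemma intertwine_pow {f : Module.End ℂ E} {g : Module.End ℂ F} (φ : E →ₗ[ℂ] F)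
    (h : ∀ x, φ (f x) = g (φ x)) (k : ℕ) (x : E) : φ ((f ^ k) x) = (g ^ k) (φ x) := by
  induction k generalizing x with
  | zero => simp
  | succ k ih => rw [pow_succ, pow_succ, Module.End.mul_apply, Module.End.mul_apply, ih, h]

lemma locExp_intertwine {f : Module.End ℂ E} {g : Module.End ℂ F} (hf : LocNil f) (hg : LocNil g)
    (φ : E →ₗ[ℂ] F) (h : ∀ x, φ (f x) = g (φ x)) (x : E) :
    φ (locExp f hf x) = locExp g hg (φ x) := by
  obtain ⟨N, hN⟩ := hf x
  have hN' : (g ^ N) (φ x) = 0 := by rw [← intertwine_pow φ h, hN, map_zero]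
  rw [locExp_eq_sum f hf x hN, locExp_eq_sum g hg _ hN', map_sum]
  simp [intertwine_pow φ h]

lemma commute_pow_apply_zero {f g : Module.End ℂ E} (h : Commute f g) {x : E} {M N : ℕ}
    (hx : (f ^ M) x = 0) : (f ^ M) ((g ^ N) x) = 0 := by
  rw [← Module.End.mul_apply, (h.pow_pow M N).eq, Module.End.mul_apply, hx, map_zero]

lemma LocNil.add {f g : Module.End ℂ E} (hf : LocNil f) (hg : LocNil g) (h : Commute f g) :
    LocNil (f + g) := fun x => by
  obtain ⟨M, hM⟩ := hf x
  obtain ⟨N, hN⟩ := hg x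
  refine ⟨M + N, ?_⟩
  rw [h.add_pow', LinearMap.sum_apply]
  refine Finset.sum_eq_zero fun ij hij => ?_
  rw [Finset.HasAntidiagonal.mem_antidiagonal] at hij
  rw [LinearMap.smul_apply]
  rcases le_or_gt M ij.1 with h1 | h1
  · rw [Module.End.mul_apply, commute_pow_apply_zero h (pow_zero_of_le hM h1), smul_zero]
  · rw [Module.End.mul_apply, pow_zero_of_le hN (by omega : N ≤ ij.2), map_zero, smul_zero]

lemma LocNil.mul {f g : Module.End ℂ E} (hf : LocNil f) (h : Commute f g) :
    LocNil (f * g) := fun x => by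
  obtain ⟨M, hM⟩ := hf x
  exact ⟨M, by rw [h.mul_pow, Module.End.mul_apply, commute_pow_apply_zero h hM]⟩

lemma LocNil.smul {f : Module.End ℂ E} (hf : LocNil f) (c : ℂ) : LocNil (c • f) := fun x => by
  obtain ⟨M, hM⟩ := hf x
  exact ⟨M, by rw [smul_pow, LinearMap.smul_apply, hM, smul_zero]⟩

lemma locExp_add {f g : Module.End ℂ E} (hf : LocNil f) (hg : LocNil g) (h : Commute f g)
    (hfg : LocNil (f + g)) (x : E) :
    locExp (f + g) hfg x = locExp f hf (locExp g hg x) := by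
  obtain ⟨M, hM⟩ := hf x
  obtain ⟨N, hN⟩ := hg x
  have hMx : (f ^ M) (locExp g hg x) = 0 := by
    rw [locExp_intertwine hg hg (f ^ M) (fun y => by
      rw [← Module.End.mul_apply, (h.pow_left M).eq, Module.End.mul_apply]), hM, map_zero]
  have hz : ∀ i j, (M ≤ i ∨ N ≤ j) → (f ^ i) ((g ^ j) x) = 0 := by
    rintro i j (h1 | h1)
    · rw [commute_pow_apply_zero h (pow_zero_of_le hM h1)]
    · rw [pow_zero_of_le hN h1, map_zero]
  have hk : ∀ k : ℕ, ((k.factorial : ℂ)⁻¹) • ((f + g) ^ k) x =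
      ∑ ij ∈ Finset.range M ×ˢ Finset.range N with ij.1 + ij.2 = k,
        ((ij.1.factorial : ℂ)⁻¹ * (ij.2.factorial : ℂ)⁻¹) • (f ^ ij.1) ((g ^ ij.2) x) := by
    intro k
    rw [h.add_pow', LinearMap.sum_apply, Finset.smul_sum]
    symm
    refine (Finset.sum_subset_zero_on_sdiff (s₂ := Finset.HasAntidiagonal.antidiagonal k) ?_ ?_ ?_)
    · intro ij hij
      rw [Finset.mem_filter] at hij
      exact Finset.HasAntidiagonal.mem_antidiagonal.2 hij.2
    · intro ij hij
      simp only [Finset.mem_sdiff, Finset.HasAntidiagonal.mem_antidiagonal, Finset.mem_filter, Finset.mem_product,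
        Finset.mem_range, not_and] at hij
      rw [LinearMap.smul_apply, Module.End.mul_apply, hz, smul_zero, smul_zero]
      by_contra hcon
      push Not at hcon
      exact hij.2 hcon hij.1
    · intro ij hij
      obtain rfl := (Finset.mem_filter.1 hij).2
      rw [LinearMap.smul_apply, Module.End.mul_apply, ← Nat.cast_smul_eq_nsmul ℂ, smul_smul]
      congr 1
      have h2 := Nat.add_choose_mul_factorial_mul_factorial ij.1 ij.2
      rw [← Nat.choose_symm_add] at h2
      rw [← h2]
      have h3 : ((ij.1 + ij.2).choose ij.1 : ℂ) ≠ 0 :=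
        Nat.cast_ne_zero.2 (Nat.choose_pos (Nat.le_add_right _ _)).ne'
      have h4 : (ij.1.factorial : ℂ) ≠ 0 := Nat.cast_ne_zero.2 (Nat.factorial_ne_zero _)
      have h5 : (ij.2.factorial : ℂ) ≠ 0 := Nat.cast_ne_zero.2 (Nat.factorial_ne_zero _)
      push_cast
      field_simp
  have hMN : ((f + g) ^ (M + N)) x = 0 := by
    have := hk (M + N)
    rw [Finset.sum_eq_zero] at this
    · rcases smul_eq_zero.1 this with h0 | h0
      · simp [Nat.factorial_ne_zero] at h0
      · exact h0
    · intro ij hij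
      simp only [Finset.mem_filter, Finset.mem_product, Finset.mem_range] at hij
      omega
  rw [locExp_eq_sum _ hfg x hMN, locExp_eq_sum f hf _ hMx, locExp_eq_sum g hg x hN]
  simp_rw [hk]
  rw [Finset.sum_fiberwise_of_maps_to (t := Finset.range (M + N))
    (g := fun ij : ℕ × ℕ => ij.1 + ij.2), Finset.sum_product]
  · refine Finset.sum_congr rfl fun i _ => ?_
    rw [map_sum, Finset.smul_sum]
    refine Finset.sum_congr rfl fun j _ => ?_
    rw [map_smul, smul_smul]
  · intro ij hij
    simp only [Finset.mem_product, Finset.mem_range] at hij ⊢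
    omega

end LocalExp

section Moyal

variable {E F : Type*} [AddCommMonoid E] [Module ℂ E] [AddCommMonoid F] [Module ℂ F] {n : ℕ}

/-- The bidifferential operator `∑ᵢ (D pᵢ ∘ D' qᵢ - D qᵢ ∘ D' pᵢ)`. -/
def biOp (D D' : Fin n ⊕ Fin n → Module.End ℂ E) : Module.End ℂ E :=
  ∑ i : Fin n, (D (.inl i) * D' (.inr i) + (-1 : ℂ) • (D (.inr i) * D' (.inl i)))

/-- `f` is locally nilpotent and lies in the algebra generated by `S`. -/
def Good (S : Set (Module.End ℂ E)) (f : Module.End ℂ E) : Prop :=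
  f ∈ Algebra.adjoin ℂ S ∧ LocNil f

variable {S : Set (Module.End ℂ E)}

lemma Good.commute {f g : Module.End ℂ E}
    (hS : ∀ f ∈ S, ∀ g ∈ S, Commute f g) (hf : Good S f) (hg : Good S g) : Commute f g :=
  Algebra.commute_of_mem_adjoin_of_forall_mem_commute hg.1 fun b hb =>
    (Algebra.commute_of_mem_adjoin_of_forall_mem_commute hf.1 fun a ha => hS b hb a ha).symm

lemma Good.add {f g : Module.End ℂ E}
    (hS : ∀ f ∈ S, ∀ g ∈ S, Commute f g) (hf : Good S f) (hg : Good S g) : Good S (f + g) :=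
  ⟨add_mem hf.1 hg.1, hf.2.add hg.2 (Good.commute hS hf hg)⟩

lemma Good.mul {f g : Module.End ℂ E}
    (hS : ∀ f ∈ S, ∀ g ∈ S, Commute f g) (hf : Good S f) (hg : Good S g) : Good S (f * g) :=
  ⟨mul_mem hf.1 hg.1, hf.2.mul (Good.commute hS hf hg)⟩

lemma Good.smul {f : Module.End ℂ E} (hf : Good S f) (c : ℂ) : Good S (c • f) :=
  ⟨Subalgebra.smul_mem _ hf.1 c, hf.2.smul c⟩

lemma Good.zero : Good S (0 : Module.End ℂ E) := ⟨zero_mem _, fun x => ⟨1, by simp⟩⟩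

lemma Good.biOp {D D' : Fin n ⊕ Fin n → Module.End ℂ E}
    (hS : ∀ f ∈ S, ∀ g ∈ S, Commute f g) (hD : ∀ i, Good S (D i))
    (hD' : ∀ i, Good S (D' i)) : Good S (biOp D D') := by
  refine Finset.sum_induction _ (Good S) (fun _ _ h1 h2 => Good.add hS h1 h2) Good.zero fun i _ => ?_
  have h := (Good.mul hS (hD (.inr i)) (hD' (.inl i))).smul (-1)
  exact Good.add hS (Good.mul hS (hD (.inl i)) (hD' (.inr i))) h

lemma biOp_intertwine (φ : E →ₗ[ℂ] F) {D D' : Fin n ⊕ Fin n → Module.End ℂ E}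
    {G G' : Fin n ⊕ Fin n → Module.End ℂ F} (h : ∀ i x, φ (D i x) = G i (φ x))
    (h' : ∀ i x, φ (D' i x) = G' i (φ x)) (x : E) : φ (biOp D D' x) = biOp G G' (φ x) := by
  simp [biOp, LinearMap.sum_apply, map_sum, h, h']

lemma biOp_add_left (D D₁ D' : Fin n ⊕ Fin n → Module.End ℂ E) :
    biOp (D + D₁) D' = biOp D D' + biOp D₁ D' := by
  simp only [biOp, ← Finset.sum_add_distrib, Pi.add_apply, add_mul, smul_add]
  exact Finset.sum_congr rfl fun i _ => add_add_add_comm _ _ _ _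

lemma biOp_add_right (D D₁ D' : Fin n ⊕ Fin n → Module.End ℂ E) :
    biOp D' (D + D₁) = biOp D' D + biOp D' D₁ := by
  simp only [biOp, ← Finset.sum_add_distrib, Pi.add_apply, mul_add, smul_add]
  exact Finset.sum_congr rfl fun i _ => add_add_add_comm _ _ _ _

variable (n) in
/-- The polynomial algebra `ℂ[p₁, q₁, …, pₙ, qₙ]`, with `pᵢ = X (inl i)` and `qᵢ = X (inr i)`. -/
abbrev Poly : Type := MvPolynomial (Fin n ⊕ Fin n) ℂ

/-- Partial derivative as a `ℂ`-linear map. -/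
def dd (i : Fin n ⊕ Fin n) : Module.End ℂ (Poly n) := (MvPolynomial.pderiv i).toLinearMap

lemma dd_commute (i j : Fin n ⊕ Fin n) : Commute (dd i) (dd j) := by
  have : ⁅MvPolynomial.pderiv (R := ℂ) i, MvPolynomial.pderiv (R := ℂ) j⁆ = 0 := by
    refine MvPolynomial.derivation_ext fun k => ?_
    rw [Derivation.commutator_apply]
    simp [MvPolynomial.pderiv_X, Pi.single_apply, apply_ite]
  refine LinearMap.ext fun x => ?_
  have := DFunLike.congr_fun this x
  rw [Derivation.commutator_apply] at this
  exact sub_eq_zero.1 this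

lemma dd_locNil (i : Fin n ⊕ Fin n) : LocNil (dd i) := by
  intro x
  induction x using MvPolynomial.induction_on' with
  | monomial u a =>
    suffices h : ∀ (N : ℕ) (u : (Fin n ⊕ Fin n) →₀ ℕ) (a : ℂ), u i < N →
        (dd i ^ N) (MvPolynomial.monomial u a) = 0 from ⟨u i + 1, h _ u a (Nat.lt_succ_self _)⟩
    intro N
    induction N with
    | zero => intro u a h; omega
    | succ N ih =>
      intro u a h
      rw [pow_succ, Module.End.mul_apply]
      change (dd i ^ N) (MvPolynomial.pderiv i (MvPolynomial.monomial u a)) = 0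
      rw [MvPolynomial.pderiv_monomial]
      rcases Nat.eq_zero_or_pos (u i) with h0 | h0
      · simp [h0]
      · refine ih _ _ ?_
        simp
        omega
  | add p q hp hq =>
    obtain ⟨M, hM⟩ := hp
    obtain ⟨N, hN⟩ := hq
    exact ⟨max M N, by rw [map_add, pow_zero_of_le hM (le_max_left _ _),
      pow_zero_of_le hN (le_max_right _ _), add_zero]⟩

lemma LocNil.rTensor {f : Module.End ℂ E} (hf : LocNil f) :
    LocNil (LinearMap.rTensor F f) := by
  intro x
  induction x with
  | zero => exact ⟨0, by simp⟩
  | tmul a b =>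
    obtain ⟨N, hN⟩ := hf a
    exact ⟨N, by rw [LinearMap.rTensor_pow, LinearMap.rTensor_tmul, hN, TensorProduct.zero_tmul]⟩
  | add p q hp hq =>
    obtain ⟨M, hM⟩ := hp
    obtain ⟨N, hN⟩ := hq
    exact ⟨max M N, by rw [map_add, pow_zero_of_le hM (le_max_left _ _),
      pow_zero_of_le hN (le_max_right _ _), add_zero]⟩

lemma LocNil.lTensor {f : Module.End ℂ E} (hf : LocNil f) :
    LocNil (LinearMap.lTensor F f) := by
  intro x
  induction x with
  | zero => exact ⟨0, by simp⟩
  | tmul a b =>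
    obtain ⟨N, hN⟩ := hf b
    exact ⟨N, by rw [LinearMap.lTensor_pow, LinearMap.lTensor_tmul, hN, TensorProduct.tmul_zero]⟩
  | add p q hp hq =>
    obtain ⟨M, hM⟩ := hp
    obtain ⟨N, hN⟩ := hq
    exact ⟨max M N, by rw [map_add, pow_zero_of_le hM (le_max_left _ _),
      pow_zero_of_le hN (le_max_right _ _), add_zero]⟩

variable (n) in
/-- The family of partial derivatives on the first factor of `P ⊗ P`. -/
def d₁ (i : Fin n ⊕ Fin n) : Module.End ℂ (Poly n ⊗[ℂ] Poly n) := (dd i).rTensor _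

variable (n) in
/-- The family of partial derivatives on the second factor of `P ⊗ P`. -/
def d₂ (i : Fin n ⊕ Fin n) : Module.End ℂ (Poly n ⊗[ℂ] Poly n) := (dd i).lTensor _

variable (n) in
/-- The Poisson bidifferential operator `∑ᵢ (∂/∂pᵢ ⊗ ∂/∂qᵢ - ∂/∂qᵢ ⊗ ∂/∂pᵢ)` on `P ⊗ P`. -/
def poissonOp : Module.End ℂ (Poly n ⊗[ℂ] Poly n) := biOp (d₁ n) (d₂ n)

/-- All the derivatives on `P ⊗ P`. -/
def S₂ (n : ℕ) : Set (Module.End ℂ (Poly n ⊗[ℂ] Poly n)) := Set.range (d₁ n) ∪ Set.range (d₂ n)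

lemma rTensor_commute {f g : Module.End ℂ E} (h : Commute f g) :
    Commute (LinearMap.rTensor F f : Module.End ℂ (E ⊗[ℂ] F)) (LinearMap.rTensor F g) := by
  change _ * _ = _ * _
  rw [← LinearMap.rTensor_mul, h.eq, LinearMap.rTensor_mul]

lemma lTensor_commute {f g : Module.End ℂ E} (h : Commute f g) :
    Commute (LinearMap.lTensor F f : Module.End ℂ (F ⊗[ℂ] E)) (LinearMap.lTensor F g) := by
  change _ * _ = _ * _
  rw [← LinearMap.lTensor_mul, h.eq, LinearMap.lTensor_mul]

lemma rlTensor_commute (f : Module.End ℂ E) (g : Module.End ℂ F) :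
    Commute (LinearMap.rTensor F f : Module.End ℂ (E ⊗[ℂ] F)) (LinearMap.lTensor E g) :=
  TensorProduct.ext' fun x y => by simp

lemma S₂_commute : ∀ f ∈ S₂ n, ∀ g ∈ S₂ n, Commute f g := by
  rintro _ (⟨i, rfl⟩ | ⟨i, rfl⟩) _ (⟨j, rfl⟩ | ⟨j, rfl⟩)
  · exact rTensor_commute (dd_commute i j)
  · exact rlTensor_commute _ _
  · exact (rlTensor_commute _ _).symm
  · exact lTensor_commute (dd_commute i j)

lemma poissonOp_good : Good (S₂ n) (poissonOp n) :=
  Good.biOp S₂_commute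
    (fun i => ⟨Algebra.subset_adjoin (.inl ⟨i, rfl⟩), (dd_locNil i).rTensor⟩)
    (fun i => ⟨Algebra.subset_adjoin (.inr ⟨i, rfl⟩), (dd_locNil i).lTensor⟩)

variable (n) in
/-- The operator `exp (½ (∑ᵢ ∂/∂pᵢ ⊗ ∂/∂qᵢ - ∂/∂qᵢ ⊗ ∂/∂pᵢ))` on `P ⊗ P`. -/
def moyalExp : Module.End ℂ (Poly n ⊗[ℂ] Poly n) :=
  locExp ((1 / 2 : ℂ) • poissonOp n) (poissonOp_good.2.smul _)

variable (n) in
/-- The Moyal product `a * b = m (exp (½ (∑ᵢ ∂/∂pᵢ ⊗ ∂/∂qᵢ - ∂/∂qᵢ ⊗ ∂/∂pᵢ)) (a ⊗ b))`, where `m`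
is the commutative multiplication of polynomials. -/
def moyal : Poly n →ₗ[ℂ] Poly n →ₗ[ℂ] Poly n :=
  TensorProduct.curry (LinearMap.mul' ℂ (Poly n) ∘ₗ moyalExp n)

lemma moyal_apply (a b : Poly n) :
    moyal n a b = LinearMap.mul' ℂ (Poly n) (moyalExp n (a ⊗ₜ b)) := rfl

lemma rTensor_biOp (D D' : Fin n ⊕ Fin n → Module.End ℂ E) :
    LinearMap.rTensor F (biOp D D') =
      biOp (fun i => LinearMap.rTensor F (D i)) (fun i => LinearMap.rTensor F (D' i)) :=
  TensorProduct.ext' fun x y => by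
    simp [biOp, LinearMap.sum_apply, TensorProduct.sum_tmul, TensorProduct.add_tmul, TensorProduct.smul_tmul']

lemma lTensor_biOp (D D' : Fin n ⊕ Fin n → Module.End ℂ E) :
    LinearMap.lTensor F (biOp D D') =
      biOp (fun i => LinearMap.lTensor F (D i)) (fun i => LinearMap.lTensor F (D' i)) :=
  TensorProduct.ext' fun x y => by
    simp [biOp, LinearMap.sum_apply, TensorProduct.tmul_sum, TensorProduct.tmul_add, TensorProduct.tmul_smul]

variable (n) in
/-- Derivatives on the three factors of `(P ⊗ P) ⊗ P`. -/
def e (k : Fin 3) (i : Fin n ⊕ Fin n) : Module.End ℂ ((Poly n ⊗[ℂ] Poly n) ⊗[ℂ] Poly n) :=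
  ![(d₁ n i).rTensor _, (d₂ n i).rTensor _, (dd i).lTensor _] k

/-- All the derivatives on `(P ⊗ P) ⊗ P`. -/
def S₃ (n : ℕ) : Set (Module.End ℂ ((Poly n ⊗[ℂ] Poly n) ⊗[ℂ] Poly n)) :=
  {f | ∃ k i, f = e n k i}

lemma S₃_commute : ∀ f ∈ S₃ n, ∀ g ∈ S₃ n, Commute f g := by
  rintro _ ⟨k, i, rfl⟩ _ ⟨l, j, rfl⟩
  fin_cases k <;> fin_cases l
  · exact rTensor_commute (S₂_commute _ (.inl ⟨_, rfl⟩) _ (.inl ⟨_, rfl⟩))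
  · exact rTensor_commute (S₂_commute _ (.inl ⟨_, rfl⟩) _ (.inr ⟨_, rfl⟩))
  · exact rlTensor_commute _ _
  · exact rTensor_commute (S₂_commute _ (.inr ⟨_, rfl⟩) _ (.inl ⟨_, rfl⟩))
  · exact rTensor_commute (S₂_commute _ (.inr ⟨_, rfl⟩) _ (.inr ⟨_, rfl⟩))
  · exact rlTensor_commute _ _
  · exact (rlTensor_commute _ _).symm
  · exact (rlTensor_commute _ _).symm
  · exact lTensor_commute (dd_commute i j)

lemma e_good (k : Fin 3) (i : Fin n ⊕ Fin n) : Good (S₃ n) (e n k i) := by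
  refine ⟨Algebra.subset_adjoin ⟨k, i, rfl⟩, ?_⟩
  fin_cases k
  · exact (dd_locNil i).rTensor.rTensor
  · exact (dd_locNil i).lTensor.rTensor
  · exact (dd_locNil i).lTensor

/-- The sum of the three pairwise Poisson operators on `(P ⊗ P) ⊗ P`. -/
def tripleOp (n : ℕ) : Module.End ℂ ((Poly n ⊗[ℂ] Poly n) ⊗[ℂ] Poly n) :=
  biOp (e n 0) (e n 1) + biOp (e n 0) (e n 2) + biOp (e n 1) (e n 2)

lemma pair_good (k l : Fin 3) : Good (S₃ n) (biOp (e n k) (e n l)) :=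
  Good.biOp S₃_commute (e_good k) (e_good l)

lemma tripleOp_good : Good (S₃ n) (tripleOp n) :=
  Good.add S₃_commute (Good.add S₃_commute (pair_good 0 1) (pair_good 0 2)) (pair_good 1 2)

lemma dd_mul (i : Fin n ⊕ Fin n) (a b : Poly n) : dd i (a * b) = dd i a * b + a * dd i b := by
  simp [dd, Derivation.leibniz]
  ring

lemma moyal_left (x : (Poly n ⊗[ℂ] Poly n) ⊗[ℂ] Poly n) :
    LinearMap.mul' ℂ (Poly n) (moyalExp n ((LinearMap.mul' ℂ (Poly n)).rTensor _
      ((moyalExp n).rTensor _ x))) =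
    LinearMap.mul' ℂ (Poly n) ((LinearMap.mul' ℂ (Poly n)).rTensor _
      (locExp ((1 / 2 : ℂ) • tripleOp n) (tripleOp_good.2.smul _) x)) := by
  have h1 : LocNil ((1 / 2 : ℂ) • biOp (e n 0) (e n 1)) := (pair_good 0 1).2.smul _
  have hg2 : Good (S₃ n) (biOp (e n 0) (e n 2) + biOp (e n 1) (e n 2)) :=
    Good.add S₃_commute (pair_good 0 2) (pair_good 1 2)
  have h2 : LocNil ((1 / 2 : ℂ) • (biOp (e n 0) (e n 2) + biOp (e n 1) (e n 2))) := hg2.2.smul _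
  have hr : (moyalExp n).rTensor (Poly n) x = locExp _ h1 x := by
    induction x with
    | zero => simp
    | add p q hp hq => simp only [map_add, hp, hq]
    | tmul a b =>
      rw [LinearMap.rTensor_tmul, moyalExp]
      refine locExp_intertwine _ h1 ((TensorProduct.mk ℂ _ (Poly n)).flip b) (fun y => ?_) a
      simp only [LinearMap.flip_apply, TensorProduct.mk_apply, LinearMap.smul_apply]
      rw [← TensorProduct.smul_tmul', poissonOp]
      congr 1
      exact LinearMap.congr_fun (rTensor_biOp (F := Poly n) (d₁ n) (d₂ n)) (y ⊗ₜ b)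
  have hm : ∀ y, (LinearMap.mul' ℂ (Poly n)).rTensor (Poly n) (locExp _ h2 y) =
      moyalExp n ((LinearMap.mul' ℂ (Poly n)).rTensor (Poly n) y) := by
    intro y
    refine locExp_intertwine h2 _ ((LinearMap.mul' ℂ (Poly n)).rTensor (Poly n)) (fun z => ?_) y
    rw [LinearMap.smul_apply, LinearMap.smul_apply, map_smul, ← biOp_add_left, poissonOp]
    congr 1
    refine biOp_intertwine _ (fun i w => ?_) (fun i w => ?_) z
    · refine LinearMap.congr_fun (f := (LinearMap.mul' ℂ (Poly n)).rTensor (Poly n) ∘ₗ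
        (e n 0 + e n 1) i) (g := d₁ n i ∘ₗ (LinearMap.mul' ℂ (Poly n)).rTensor (Poly n)) ?_ w
      refine TensorProduct.ext_threefold fun a b c => ?_
      simp [e, d₁, d₂, dd_mul, TensorProduct.add_tmul]
    · refine LinearMap.congr_fun (f := (LinearMap.mul' ℂ (Poly n)).rTensor (Poly n) ∘ₗ
        (e n 2) i) (g := d₂ n i ∘ₗ (LinearMap.mul' ℂ (Poly n)).rTensor (Poly n)) ?_ w
      refine TensorProduct.ext_threefold fun a b c => ?_
      simp [e, d₂]
  have h3 : LocNil ((1 / 2 : ℂ) • (biOp (e n 0) (e n 2) + biOp (e n 1) (e n 2)) +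
      (1 / 2 : ℂ) • biOp (e n 0) (e n 1)) :=
    (Good.add S₃_commute (hg2.smul _) ((pair_good 0 1).smul _)).2
  rw [hr, ← hm, ← locExp_add h2 h1 (Good.commute S₃_commute (hg2.smul _)
    ((pair_good 0 1).smul _)) h3]
  congr 2
  refine locExp_congr ?_ _ _ _
  rw [← smul_add, tripleOp]
  congr 1
  rw [add_comm, add_assoc]

lemma moyal_right (x : (Poly n ⊗[ℂ] Poly n) ⊗[ℂ] Poly n) :
    LinearMap.mul' ℂ (Poly n) (moyalExp n ((LinearMap.mul' ℂ (Poly n)).lTensor _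
      ((moyalExp n).lTensor _ (TensorProduct.assoc ℂ _ _ _ x)))) =
    LinearMap.mul' ℂ (Poly n) ((LinearMap.mul' ℂ (Poly n)).rTensor _
      (locExp ((1 / 2 : ℂ) • tripleOp n) (tripleOp_good.2.smul _) x)) := by
  have h1 : LocNil ((1 / 2 : ℂ) • biOp (e n 1) (e n 2)) := (pair_good 1 2).2.smul _
  have hg2 : Good (S₃ n) (biOp (e n 0) (e n 1) + biOp (e n 0) (e n 2)) :=
    Good.add S₃_commute (pair_good 0 1) (pair_good 0 2)
  have h2 : LocNil ((1 / 2 : ℂ) • (biOp (e n 0) (e n 1) + biOp (e n 0) (e n 2))) := hg2.2.smul _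
  have hr : (moyalExp n).lTensor (Poly n) (TensorProduct.assoc ℂ _ _ _ x) =
      TensorProduct.assoc ℂ _ _ _ (locExp _ h1 x) := by
    obtain ⟨y, rfl⟩ := (TensorProduct.assoc ℂ (Poly n) (Poly n) (Poly n)).symm.surjective x
    rw [LinearEquiv.apply_symm_apply, ← LinearEquiv.symm_apply_eq]
    induction y with
    | zero => simp
    | add p q hp hq => simp only [map_add, hp, hq]
    | tmul a b =>
      rw [LinearMap.lTensor_tmul, moyalExp]
      refine locExp_intertwine _ h1 ((TensorProduct.assoc ℂ _ _ _).symm.toLinearMap ∘ₗ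
        TensorProduct.mk ℂ (Poly n) (Poly n ⊗[ℂ] Poly n) a) (fun y => ?_) b
      rw [LinearMap.smul_apply, LinearMap.smul_apply, map_smul, poissonOp]
      congr 1
      refine biOp_intertwine _ (fun i w => ?_) (fun i w => ?_) y
      · refine LinearMap.congr_fun (f := ((TensorProduct.assoc ℂ _ _ _).symm.toLinearMap ∘ₗ
          TensorProduct.mk ℂ (Poly n) (Poly n ⊗[ℂ] Poly n) a) ∘ₗ d₁ n i) (g := e n 1 i ∘ₗ
          ((TensorProduct.assoc ℂ _ _ _).symm.toLinearMap ∘ₗ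
          TensorProduct.mk ℂ (Poly n) (Poly n ⊗[ℂ] Poly n) a)) ?_ w
        refine TensorProduct.ext' fun b c => ?_
        simp [e, d₁, d₂]
      · refine LinearMap.congr_fun (f := ((TensorProduct.assoc ℂ _ _ _).symm.toLinearMap ∘ₗ
          TensorProduct.mk ℂ (Poly n) (Poly n ⊗[ℂ] Poly n) a) ∘ₗ d₂ n i) (g := e n 2 i ∘ₗ
          ((TensorProduct.assoc ℂ _ _ _).symm.toLinearMap ∘ₗ
          TensorProduct.mk ℂ (Poly n) (Poly n ⊗[ℂ] Poly n) a)) ?_ w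
        refine TensorProduct.ext' fun b c => ?_
        simp [e, d₂]
  have hm : ∀ y, (LinearMap.mul' ℂ (Poly n)).lTensor (Poly n)
      (TensorProduct.assoc ℂ _ _ _ (locExp _ h2 y)) =
      moyalExp n ((LinearMap.mul' ℂ (Poly n)).lTensor (Poly n)
        (TensorProduct.assoc ℂ _ _ _ y)) := by
    intro y
    refine locExp_intertwine h2 _ ((LinearMap.mul' ℂ (Poly n)).lTensor (Poly n) ∘ₗ
      (TensorProduct.assoc ℂ (Poly n) (Poly n) (Poly n)).toLinearMap) (fun z => ?_) y
    rw [LinearMap.smul_apply, LinearMap.smul_apply, map_smul, ← biOp_add_right, poissonOp]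
    congr 1
    refine biOp_intertwine _ (fun i w => ?_) (fun i w => ?_) z
    · refine LinearMap.congr_fun (f := ((LinearMap.mul' ℂ (Poly n)).lTensor (Poly n) ∘ₗ
        (TensorProduct.assoc ℂ (Poly n) (Poly n) (Poly n)).toLinearMap) ∘ₗ
        (e n 0) i) (g := d₁ n i ∘ₗ ((LinearMap.mul' ℂ (Poly n)).lTensor (Poly n) ∘ₗ
        (TensorProduct.assoc ℂ (Poly n) (Poly n) (Poly n)).toLinearMap)) ?_ w
      refine TensorProduct.ext_threefold fun a b c => ?_
      simp [e, d₁]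
    · refine LinearMap.congr_fun (f := ((LinearMap.mul' ℂ (Poly n)).lTensor (Poly n) ∘ₗ
        (TensorProduct.assoc ℂ (Poly n) (Poly n) (Poly n)).toLinearMap) ∘ₗ
        (e n 1 + e n 2) i) (g := d₂ n i ∘ₗ ((LinearMap.mul' ℂ (Poly n)).lTensor (Poly n) ∘ₗ
        (TensorProduct.assoc ℂ (Poly n) (Poly n) (Poly n)).toLinearMap)) ?_ w
      refine TensorProduct.ext_threefold fun a b c => ?_
      simp [e, d₂, dd_mul, TensorProduct.tmul_add]
  have h3 : LocNil ((1 / 2 : ℂ) • (biOp (e n 0) (e n 1) + biOp (e n 0) (e n 2)) +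
      (1 / 2 : ℂ) • biOp (e n 1) (e n 2)) :=
    (Good.add S₃_commute (hg2.smul _) ((pair_good 1 2).smul _)).2
  have hmm : ∀ y : (Poly n ⊗[ℂ] Poly n) ⊗[ℂ] Poly n, LinearMap.mul' ℂ (Poly n)
      ((LinearMap.mul' ℂ (Poly n)).lTensor (Poly n) (TensorProduct.assoc ℂ _ _ _ y)) =
      LinearMap.mul' ℂ (Poly n) ((LinearMap.mul' ℂ (Poly n)).rTensor _ y) := by
    intro y
    refine LinearMap.congr_fun (f := LinearMap.mul' ℂ (Poly n) ∘ₗ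
      (LinearMap.mul' ℂ (Poly n)).lTensor (Poly n) ∘ₗ
      (TensorProduct.assoc ℂ (Poly n) (Poly n) (Poly n)).toLinearMap)
      (g := LinearMap.mul' ℂ (Poly n) ∘ₗ (LinearMap.mul' ℂ (Poly n)).rTensor (Poly n)) ?_ y
    refine TensorProduct.ext_threefold fun a b c => ?_
    simp [mul_assoc]
  rw [hr, ← hm, ← locExp_add h2 h1 (Good.commute S₃_commute (hg2.smul _)
    ((pair_good 1 2).smul _)) h3, hmm]
  congr 2
  refine locExp_congr ?_ _ _ _
  rw [← smul_add, tripleOp]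

lemma moyal_assoc (a b c : Poly n) : moyal n (moyal n a b) c = moyal n a (moyal n b c) :=
  (moyal_left ((a ⊗ₜ b) ⊗ₜ c)).trans (moyal_right ((a ⊗ₜ b) ⊗ₜ c)).symm

lemma dd_one (i : Fin n ⊕ Fin n) : dd i (1 : Poly n) = 0 := by simp [dd]

lemma moyal_eq_sum (a b : Poly n) {N : ℕ} (h : (poissonOp n ^ N) (a ⊗ₜ b) = 0) :
    moyal n a b = ∑ k ∈ Finset.range N, ((k.factorial : ℂ)⁻¹ * (1 / 2) ^ k) •
      LinearMap.mul' ℂ (Poly n) ((poissonOp n ^ k) (a ⊗ₜ b)) := by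
  rw [moyal_apply, moyalExp, locExp_eq_sum (N := N), map_sum]
  · simp [smul_pow, smul_smul]
  · rw [smul_pow, LinearMap.smul_apply, h, smul_zero]

lemma one_moyal (a : Poly n) : moyal n 1 a = a := by
  rw [moyal_eq_sum (N := 1)]
  · simp
  · simp [poissonOp, biOp, LinearMap.sum_apply, d₁, d₂, dd_one]

lemma moyal_one (a : Poly n) : moyal n a 1 = a := by
  rw [moyal_eq_sum (N := 1)]
  · simp
  · simp [poissonOp, biOp, LinearMap.sum_apply, d₁, d₂, dd_one]

lemma poissonOp_X (i j : Fin n ⊕ Fin n) :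
    ∃ c : ℂ, poissonOp n (MvPolynomial.X i ⊗ₜ MvPolynomial.X j) = c • ((1 : Poly n) ⊗ₜ 1) := by
  have h : ∀ i j : Fin n ⊕ Fin n, dd i (MvPolynomial.X j : Poly n) =
      (if i = j then (1 : ℂ) else 0) • (1 : Poly n) := by
    intro i j
    change MvPolynomial.pderiv i _ = _
    rw [MvPolynomial.pderiv_X, Pi.single_apply]
    split_ifs <;> simp_all
  refine ⟨∑ k : Fin n, ((if Sum.inl k = i then 1 else 0) * (if Sum.inr k = j then 1 else 0) +
    -1 * ((if Sum.inr k = i then 1 else 0) * (if Sum.inl k = j then 1 else 0))), ?_⟩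
  simp only [poissonOp, biOp, LinearMap.sum_apply, LinearMap.add_apply, LinearMap.smul_apply,
    Module.End.mul_apply, d₁, d₂, LinearMap.lTensor_tmul, LinearMap.rTensor_tmul, h,
    TensorProduct.smul_tmul_smul, Finset.sum_smul, add_smul, mul_smul (-1 : ℂ)]

lemma moyal_X_sub (i j : Fin n ⊕ Fin n) : ∃ c : ℂ,
    moyal n (MvPolynomial.X i) (MvPolynomial.X j) - moyal n (MvPolynomial.X j) (MvPolynomial.X i) =
      c • 1 := by
  have h : ∀ i j : Fin n ⊕ Fin n, ∃ c : ℂ, moyal n (MvPolynomial.X i) (MvPolynomial.X j) =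
      MvPolynomial.X i * MvPolynomial.X j + c • 1 := by
    intro i j
    obtain ⟨c, hc⟩ := poissonOp_X i j
    refine ⟨(1 / 2) * c, ?_⟩
    rw [moyal_eq_sum (N := 2)]
    · simp [Finset.sum_range_succ, hc, smul_smul]
    · rw [pow_two, Module.End.mul_apply, hc, map_smul]
      simp [poissonOp, biOp, LinearMap.sum_apply, d₁, d₂, dd_one]
  obtain ⟨c, hc⟩ := h i j
  obtain ⟨c', hc'⟩ := h j i
  exact ⟨c - c', by rw [hc, hc', mul_comm, sub_smul]; abel⟩

end Moyal

end Weyl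

/-- The Weyl algebra: the space `ℂ[p₁, q₁, …, pₙ, qₙ]` with the Moyal product. -/
def Weyl (n : ℕ) : Type := Weyl.Poly n

namespace Weyl

variable {n : ℕ}

instance : AddCommGroup (Weyl n) := inferInstanceAs (AddCommGroup (Weyl.Poly n))

instance : Module ℂ (Weyl n) := inferInstanceAs (Module ℂ (Weyl.Poly n))

/-- The polynomial underlying an element of the Weyl algebra, as a linear equivalence. -/
def toPoly : Weyl n ≃ₗ[ℂ] Weyl.Poly n := LinearEquiv.refl ℂ (Weyl.Poly n)

instance : Ring (Weyl n) :=
  { (inferInstance : AddCommGroup (Weyl n)) with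
    one := toPoly.symm 1
    mul := fun a b => toPoly.symm (moyal n (toPoly a) (toPoly b))
    left_distrib := fun a b c => map_add (moyal n a) b c
    right_distrib := fun a b c => LinearMap.map_add₂ (moyal n) a b c
    zero_mul := fun a => LinearMap.map_zero₂ (moyal n) a
    mul_zero := fun a => map_zero (moyal n a)
    mul_assoc := moyal_assoc
    one_mul := one_moyal
    mul_one := moyal_one }

lemma mul_def (a b : Weyl n) : a * b = toPoly.symm (moyal n (toPoly a) (toPoly b)) := rfl

instance : Algebra ℂ (Weyl n) :=
  Algebra.ofModule (fun c a b => LinearMap.map_smul₂ (moyal n) c a b)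
    (fun c a b => map_smul (moyal n a) c b)

/-- The generators: `Z (inl i) = pᵢ` and `Z (inr i) = qᵢ`. -/
def Z (i : Fin n ⊕ Fin n) : Weyl n := toPoly.symm (MvPolynomial.X i)

variable (n) in
/-- The span `V` of the generators. -/
def V : Submodule ℂ (Weyl n) := Submodule.span ℂ (Set.range Z)

/-- The generator `Zᵢ` as an element of `V`. -/
def ZV (i : Fin n ⊕ Fin n) : V n := ⟨Z i, Submodule.subset_span ⟨i, rfl⟩⟩

/-- The coordinate form `Zᵢ*` on `V`: the coefficient of `Zᵢ`. -/
def Zdual (i : Fin n ⊕ Fin n) : V n →ₗ[ℂ] ℂ :=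
  MvPolynomial.lcoeff ℂ (Finsupp.single i 1) ∘ₗ toPoly.toLinearMap ∘ₗ (V n).subtype

lemma Zdual_Z (i j : Fin n ⊕ Fin n) : Zdual i (ZV j) = if j = i then 1 else 0 := by
  change MvPolynomial.coeff (Finsupp.single i 1) (MvPolynomial.X j : Poly n) = _
  rw [MvPolynomial.coeff_X]
  simp [Finsupp.single_left_inj]

lemma sum_Zdual (v : V n) : ∑ i, Zdual i v • Z i = (v : Weyl n) := by
  obtain ⟨v, hv⟩ := v
  induction hv using Submodule.span_induction with
  | mem x hx =>
    obtain ⟨j, rfl⟩ := hx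
    have := fun i => Zdual_Z i j
    simp only [ZV] at this
    simp [this]
  | zero =>
    have : (⟨0, zero_mem _⟩ : V n) = 0 := rfl
    simp [this]
  | add x y hx hy h1 h2 =>
    have : (⟨x + y, add_mem hx hy⟩ : V n) = ⟨x, hx⟩ + ⟨y, hy⟩ := rfl
    simp only [this, map_add, add_smul, Finset.sum_add_distrib, h1, h2]
  | smul a x hx h =>
    have : (⟨a • x, Submodule.smul_mem _ a hx⟩ : V n) = a • ⟨x, hx⟩ := rfl
    simp only [this, map_smul, smul_assoc, ← Finset.smul_sum, h]

lemma Z_commutator (i j : Fin n ⊕ Fin n) :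
    ∃ c : ℂ, (Z i * Z j - Z j * Z i : Weyl n) = algebraMap ℂ (Weyl n) c := by
  obtain ⟨c, hc⟩ := moyal_X_sub i j
  exact ⟨c, by rw [Algebra.algebraMap_eq_smul_one]; exact hc⟩

lemma V_commutator (v w : V n) :
    ∃ c : ℂ, (v * w - w * v : Weyl n) = algebraMap ℂ (Weyl n) c := by
  choose c hc using fun i j => Z_commutator (n := n) i j
  refine ⟨∑ i, ∑ j, Zdual i v * Zdual j w * c i j, ?_⟩
  rw [← sum_Zdual v, ← sum_Zdual w, Finset.sum_mul_sum, Finset.sum_mul_sum, Finset.sum_comm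
    (f := fun i j => (Zdual i w • Z i) * (Zdual j v • Z j)), map_sum, ← Finset.sum_sub_distrib]
  refine Finset.sum_congr rfl fun i _ => ?_
  rw [map_sum, ← Finset.sum_sub_distrib]
  refine Finset.sum_congr rfl fun j _ => ?_
  rw [map_mul, ← hc, ← Algebra.smul_def, smul_mul_smul_comm, smul_mul_smul_comm, smul_sub,
    mul_comm (Zdual j w)]

end Weyl
end

noncomputable section

namespace Hochschild

open MulOpposite

variable {R A M : Type*} [CommRing R] [Ring A] [Algebra R A] [AddCommGroup M] [Module R M]
  [Module A M] [Module Aᵐᵒᵖ M] [IsScalarTower R A M] [IsScalarTower R Aᵐᵒᵖ M]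
  [SMulCommClass A Aᵐᵒᵖ M] {k : ℕ}

/-- The tuple obtained from `v` by replacing the consecutive entries `v i, v (i + 1)` by their
product. -/
abbrev contract (i : Fin k) (v : Fin (k + 1) → A) : Fin k → A :=
  Fin.contractNth i.castSucc (· * ·) v

/-- The Hochschild differential
`(d f)(v₀, …, vₖ) = v₀ f(v₁, …, vₖ) + ∑ᵢ (-1)ⁱ⁺¹ f(…, vᵢ vᵢ₊₁, …) + (-1)ᵏ⁺¹ f(v₀, …, vₖ₋₁) vₖ`
as an operation on functions. -/
def dFun (f : (Fin k → A) → M) (v : Fin (k + 1) → A) : M :=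
  v 0 • f (Fin.tail v) + ∑ i : Fin k, (-1 : ℤ) ^ ((i : ℕ) + 1) • f (contract i v) +
    (-1 : ℤ) ^ (k + 1) • op (v (Fin.last k)) • f (Fin.init v)

lemma contract_apply (i : Fin k) (v : Fin (k + 1) → A) (l : Fin k) :
    contract i v l = if (l : ℕ) < i then v l.castSucc else
      if (l : ℕ) = i then v l.castSucc * v l.succ else v l.succ := rfl

lemma contract_update (i : Fin k) (v : Fin (k + 1) → A) (j : Fin (k + 1)) :
    ∃ (l : Fin k) (φ : A →ₗ[R] A), ∀ x,
      contract i (Function.update v j x) = Function.update (contract i v) l (φ x) := by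
  rcases lt_trichotomy (j : ℕ) i with h | h | h
  · refine ⟨⟨j, by omega⟩, LinearMap.id, fun x => funext fun l => ?_⟩
    simp only [contract_apply, Function.update_apply, Fin.ext_iff, Fin.val_succ, Fin.val_castSucc,
      LinearMap.id_apply]
    grind
  · refine ⟨⟨j, by omega⟩, LinearMap.mulRight R (v i.succ), fun x => funext fun l => ?_⟩
    simp only [contract_apply, Function.update_apply, Fin.ext_iff, Fin.val_succ, Fin.val_castSucc,
      LinearMap.mulRight_apply]
    by_cases hl : l = i
    · subst hl; simp [h]
    · have : (l : ℕ) ≠ i := fun h => hl (Fin.ext h)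
      grind
  · by_cases h' : (j : ℕ) = i + 1
    · refine ⟨i, LinearMap.mulLeft R (v i.castSucc), fun x => funext fun l => ?_⟩
      simp only [contract_apply, Function.update_apply, Fin.ext_iff, Fin.val_succ,
        Fin.val_castSucc, LinearMap.mulLeft_apply]
      by_cases hl : l = i
      · subst hl; simp [h']
      · have : (l : ℕ) ≠ i := fun h => hl (Fin.ext h)
        grind
    · refine ⟨⟨j - 1, by omega⟩, LinearMap.id, fun x => funext fun l => ?_⟩
      simp only [contract_apply, Function.update_apply, Fin.ext_iff, Fin.val_succ,
        Fin.val_castSucc, LinearMap.id_apply]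
      grind

lemma dFun_update (f : MultilinearMap R (fun _ : Fin k => A) M) (v : Fin (k + 1) → A)
    (j : Fin (k + 1)) : ∃ ψ : A →ₗ[R] M, ∀ x, dFun f (Function.update v j x) = ψ x := by
  have h1 : ∃ ψ : A →ₗ[R] M, ∀ x, (Function.update v j x) 0 •
      f (Fin.tail (Function.update v j x)) = ψ x := by
    induction j using Fin.cases with
    | zero => exact ⟨(LinearMap.toSpanSingleton A M (f (Fin.tail v))).restrictScalars R,
        fun x => by simp⟩
    | succ j =>
      refine ⟨Algebra.lsmul R R M (v 0) ∘ₗ f.toLinearMap (Fin.tail v) j, fun x => ?_⟩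
      rw [Fin.tail_update_succ, Function.update_of_ne (Fin.succ_ne_zero j).symm]
      simp
  have h2 : ∀ i : Fin k, ∃ ψ : A →ₗ[R] M, ∀ x,
      f (contract i (Function.update v j x)) = ψ x := by
    intro i
    obtain ⟨l, φ, h⟩ := contract_update (R := R) i v j
    exact ⟨f.toLinearMap (contract i v) l ∘ₗ φ, fun x => by rw [h]; simp⟩
  have h3 : ∃ ψ : A →ₗ[R] M, ∀ x, op ((Function.update v j x) (Fin.last k)) •
      f (Fin.init (Function.update v j x)) = ψ x := by
    induction j using Fin.lastCases with
    | last => exact ⟨(LinearMap.toSpanSingleton Aᵐᵒᵖ M (f (Fin.init v))).restrictScalars R ∘ₗ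
        (opLinearEquiv R).toLinearMap, fun x => by simp⟩
    | cast j =>
      refine ⟨Algebra.lsmul R R M (op (v (Fin.last k))) ∘ₗ f.toLinearMap (Fin.init v) j,
        fun x => ?_⟩
      rw [Fin.init_update_castSucc, Function.update_of_ne (Fin.castSucc_ne_last j).symm]
      simp
  obtain ⟨ψ₁, h1⟩ := h1
  choose ψ₂ h2 using h2
  obtain ⟨ψ₃, h3⟩ := h3
  refine ⟨ψ₁ + ∑ i : Fin k, (-1 : ℤ) ^ ((i : ℕ) + 1) • ψ₂ i + (-1 : ℤ) ^ (k + 1) • ψ₃,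
    fun x => ?_⟩
  simp only [dFun, h1, h2, h3, LinearMap.add_apply, LinearMap.sum_apply, LinearMap.smul_apply]

/-- The Hochschild differential on multilinear maps. -/
def dMulti (f : MultilinearMap R (fun _ : Fin k => A) M) :
    MultilinearMap R (fun _ : Fin (k + 1) => A) M :=
  MultilinearMap.mk' (dFun f)
    (fun v j x y => by
      obtain ⟨ψ, h⟩ := dFun_update f v j
      simp only [h, map_add])
    (fun v j c x => by
      obtain ⟨ψ, h⟩ := dFun_update f v j
      simp only [h, map_smul])

lemma dMulti_apply (f : MultilinearMap R (fun _ : Fin k => A) M) (v : Fin (k + 1) → A) :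
    dMulti f v = dFun f v := rfl

/-- The function `b ↦ b₀ f(b₁, …, bₖ) bₖ₊₁`. -/
def lift (f : (Fin k → A) → M) (b : Fin (k + 2) → A) : M :=
  b 0 • op (b (Fin.last _)) • f (Fin.tail (Fin.init b))

/-- The dual bar differential. -/
def barD (F : (Fin (k + 1) → A) → M) (b : Fin (k + 2) → A) : M :=
  ∑ i : Fin (k + 1), (-1 : ℤ) ^ (i : ℕ) • F (contract i b)

lemma contract_contract (b : Fin (k + 2) → A) (i : Fin k) (j : Fin (k + 1))
    (h : (j : ℕ) ≤ i) : contract i (contract j b) =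
      contract ⟨j, lt_of_le_of_lt h i.2⟩ (contract i.succ b) := by
  funext l
  simp only [contract_apply, Fin.val_succ, Fin.val_castSucc]
  have := mul_assoc (b l.castSucc.castSucc) (b l.succ.castSucc) (b l.succ.succ)
  have := Fin.succ_castSucc l
  split_ifs <;> first | omega | grind 

lemma barD_barD (F : (Fin (k + 1) → A) → M) (b : Fin (k + 3) → A) : barD (barD F) b = 0 := by
  simp only [barD, Finset.smul_sum, smul_smul]
  rw [← Finset.sum_product', Finset.univ_product_univ]
  let P := Fin (k + 2) × Fin (k + 1)
  let S : Finset P := {ij : P | (ij.1 : ℕ) ≤ ij.2}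
  rw [← Finset.sum_add_sum_compl S, ← eq_neg_iff_add_eq_zero, ← Finset.sum_neg_distrib]
  refine Finset.sum_bij (fun (ij : P) hij => ((ij.2.succ,
    ⟨ij.1, lt_of_le_of_lt (Finset.mem_filter.mp hij).2 ij.2.2⟩) : P)) ?_ ?_ ?_ ?_
  · rintro ⟨i, j⟩ hij
    simp only [S, Finset.compl_filter, Finset.mem_filter_univ, Fin.val_succ] at hij ⊢
    omega
  · rintro ⟨i, j⟩ hij ⟨i', j'⟩ hij' h
    have h1 := congrArg (fun p : P => (p.1 : ℕ)) h
    have h2 := congrArg (fun p : P => (p.2 : ℕ)) h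
    simp only [Fin.val_succ, add_left_inj] at h1 h2
    exact Prod.ext (Fin.ext h2) (Fin.ext h1)
  · rintro ⟨i, j⟩ hij
    simp only [S, Finset.compl_filter, Finset.mem_filter_univ, not_le] at hij
    refine ⟨(j.castSucc, ⟨i - 1, by omega⟩), ?_, ?_⟩
    · simp only [S, Finset.mem_filter_univ, Fin.val_castSucc]
      omega
    · refine Prod.ext (Fin.ext ?_) (Fin.ext rfl)
      change (i : ℕ) - 1 + 1 = i
      omega
  · rintro ⟨i, j⟩ hij
    simp only [S, Finset.mem_filter_univ] at hij
    rw [contract_contract _ _ _ hij, ← neg_smul]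
    congr 1
    simp only [Fin.val_succ, pow_succ]
    ring

lemma lift_dFun (f : (Fin k → A) → M) : lift (dFun f) = barD (lift f) := by
  funext b
  have h0 : lift f (contract 0 b) = b 0 • op (b (Fin.last _)) •
      (Fin.tail (Fin.init b)) 0 • f (Fin.tail (Fin.tail (Fin.init b))) := by
    have e1 : contract 0 b 0 = b 0 * b 1 := by simp [contract_apply]
    have e2 : contract 0 b (Fin.last _) = b (Fin.last _) := by simp [contract_apply]
    have e3 : Fin.tail (Fin.init (contract 0 b)) = Fin.tail (Fin.tail (Fin.init b)) := by
      funext l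
      simp [contract_apply, Fin.tail, Fin.init]
    rw [lift, e1, e2, e3, mul_smul, smul_comm (b 1)]
    rfl
  have hlast : lift f (contract (Fin.last (k + 1)) b) = b 0 • op (b (Fin.last _)) •
      op ((Fin.tail (Fin.init b)) (Fin.last k)) • f (Fin.init (Fin.tail (Fin.init b))) := by
    have e1 : contract (Fin.last (k + 1)) b 0 = b 0 := by simp [contract_apply]
    have e2 : contract (Fin.last (k + 1)) b (Fin.last _) =
        b (Fin.last _).castSucc * b (Fin.last _) := by simp [contract_apply]
    have e3 : Fin.tail (Fin.init (contract (Fin.last (k + 1)) b)) =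
        Fin.init (Fin.tail (Fin.init b)) := by
      funext l
      simp [contract_apply, Fin.tail, Fin.init]
    rw [lift, e1, e2, e3, op_mul, mul_smul]
    rfl
  have hmid : ∀ i : Fin k, lift f (contract i.castSucc.succ b) = b 0 • op (b (Fin.last _)) •
      f (contract i (Fin.tail (Fin.init b))) := by
    intro i
    have e1 : contract i.castSucc.succ b 0 = b 0 := by simp [contract_apply]
    have e2 : contract i.castSucc.succ b (Fin.last _) = b (Fin.last _) := by
      have := i.2
      simp only [contract_apply, Fin.val_last, Fin.val_succ, Fin.val_castSucc, Fin.succ_last]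
      rw [if_neg (by omega), if_neg (by omega)]
    have e3 : Fin.tail (Fin.init (contract i.castSucc.succ b)) =
        contract i (Fin.tail (Fin.init b)) := by
      funext l
      simp [contract_apply, Fin.tail, Fin.init]
    rw [lift, e1, e2, e3]
  have hl : (Fin.last k).succ = Fin.last (k + 1) := rfl
  rw [barD, Fin.sum_univ_succ, Fin.sum_univ_castSucc]
  simp only [hl, hmid, h0, hlast]
  simp only [lift, dFun, smul_add, Finset.smul_sum]
  simp only [Fin.val_zero, pow_zero, one_smul, Fin.val_succ, Fin.val_castSucc, Fin.val_last,
    smul_comm _ ((-1 : ℤ) ^ _), add_assoc]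

lemma lift_cons_snoc (f : (Fin k → A) → M) (v : Fin k → A) :
    lift f (Fin.cons 1 (Fin.snoc v 1 : Fin (k + 1) → A)) = f v := by
  have e1 : (Fin.cons 1 (Fin.snoc v 1 : Fin (k + 1) → A) : Fin (k + 2) → A) (Fin.last _) = 1 := by
    rw [← Fin.succ_last, Fin.cons_succ, Fin.snoc_last]
  have e2 : Fin.tail (Fin.init (Fin.cons 1 (Fin.snoc v 1 : Fin (k + 1) → A) :
      Fin (k + 2) → A)) = v := by
    funext l
    simp only [Fin.tail, Fin.init]
    rw [← Fin.succ_castSucc, Fin.cons_succ, Fin.snoc_castSucc]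
  rw [lift, e1, e2, Fin.cons_zero, op_one, one_smul, one_smul]

lemma dFun_dFun (f : (Fin k → A) → M) (v : Fin (k + 2) → A) : dFun (dFun f) v = 0 := by
  rw [← lift_cons_snoc (dFun (dFun f)), lift_dFun, lift_dFun, barD_barD]

lemma dFun_eq_zero (f : (Fin k → A) → M) (hf : ∀ v, (∃ i, v i = 1) → f v = 0)
    (v : Fin (k + 1) → A) (j : Fin (k + 1)) (hj : v j = 1) : dFun f v = 0 := by
  rw [← lift_cons_snoc (dFun f), lift_dFun]
  set b : Fin (k + 3) → A := Fin.cons 1 (Fin.snoc v 1 : Fin (k + 2) → A)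
  have hb : b j.castSucc.succ = 1 := by
    simp only [b]
    rw [Fin.cons_succ, Fin.snoc_castSucc, hj]
  have hF : ∀ c : Fin (k + 2) → A, (∃ l : Fin k, c l.castSucc.succ = 1) → lift f c = 0 := by
    rintro c ⟨l, hl⟩
    rw [lift, hf _ ⟨l, ?_⟩, smul_zero, smul_zero]
    exact hl
  rw [barD, Fintype.sum_eq_add j.castSucc j.succ (by simp [Fin.ext_iff])]
  · have : contract j.castSucc b = contract j.succ b := by
      funext l
      simp only [contract_apply, Fin.val_castSucc, Fin.val_succ]
      rcases lt_trichotomy (l : ℕ) j with h | h | h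
      · rw [if_pos h, if_pos (by omega)]
      · obtain rfl : l = j.castSucc := Fin.ext h
        simp [hb]
      · rw [if_neg (by omega), if_neg (by omega), if_neg (by omega)]
        split_ifs with h'
        · obtain rfl : l = j.succ := Fin.ext h'
          have : j.succ.castSucc = j.castSucc.succ := rfl
          rw [this, hb, one_mul]
        · rfl
    rw [this, ← add_smul, Fin.val_succ, Fin.val_castSucc, pow_succ]
    simp
  · rintro i ⟨h1, h2⟩
    rw [hF, smul_zero]
    have h1 : (i : ℕ) ≠ j := fun h => h1 (Fin.ext h)
    have h2 : (i : ℕ) ≠ j + 1 := fun h => h2 (Fin.ext h)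
    have hj := j.2
    have hi := i.2
    rcases lt_or_gt_of_ne h1 with h | h
    · refine ⟨⟨j - 1, by omega⟩, ?_⟩
      simp only [contract_apply, Fin.val_castSucc, Fin.val_succ]
      rw [if_neg (by omega), if_neg (by omega), ← hb]
      congr 1
      ext
      simp
      omega
    · refine ⟨⟨j, by omega⟩, ?_⟩
      simp only [contract_apply, Fin.val_castSucc, Fin.val_succ]
      rw [if_pos (by omega), ← hb]
      rfl

variable (R A M) in
/-- The module of normalized Hochschild `k`-cochains `L(⊗ᵏ (A / R·1), M)`: the `R`-multilinear maps
`Aᵏ → M` that vanish as soon as one of the arguments is a scalar. -/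
def Cochain (k : ℕ) : Submodule R (MultilinearMap R (fun _ : Fin k => A) M) where
  carrier := {f | ∀ v, (∃ i, v i ∈ Set.range (algebraMap R A)) → f v = 0}
  add_mem' hf hg v hv := by
    rw [_root_.add_apply, hf v hv, hg v hv, add_zero]
  zero_mem' _ _ := rfl
  smul_mem' c f hf v hv := by
    rw [_root_.smul_apply, hf v hv, smul_zero]

lemma mem_cochain_iff_one (f : MultilinearMap R (fun _ : Fin k => A) M) :
    f ∈ Cochain R A M k ↔ ∀ v, (∃ i, v i = 1) → f v = 0 := by
  refine ⟨fun h v ⟨i, hi⟩ => h v ⟨i, 1, by rw [map_one, hi]⟩, fun h v ⟨i, c, hc⟩ => ?_⟩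
  have h1 : v = Function.update (Function.update v i 1) i (c • (1 : A)) := by
    rw [Function.update_idem, ← Algebra.algebraMap_eq_smul_one, hc, Function.update_eq_self]
  rw [h1, f.map_update_smul, Function.update_idem, h _ ⟨i, Function.update_self _ _ _⟩, smul_zero]

lemma dMulti_mem {f : MultilinearMap R (fun _ : Fin k => A) M} (hf : f ∈ Cochain R A M k) :
    dMulti f ∈ Cochain R A M (k + 1) := by
  rw [mem_cochain_iff_one] at hf ⊢
  rintro v ⟨j, hj⟩
  exact dFun_eq_zero f hf v j hj

variable (R A M) in
/-- The differential of the normalized Hochschild complex. -/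
def d (k : ℕ) : Cochain R A M k →ₗ[R] Cochain R A M (k + 1) where
  toFun f := ⟨dMulti f.1, dMulti_mem f.2⟩
  map_add' f g := by
    refine Subtype.ext (MultilinearMap.ext fun v => ?_)
    simp only [dMulti_apply, dFun, Submodule.coe_add, _root_.add_apply, smul_add,
      Finset.sum_add_distrib]
    abel
  map_smul' c f := by
    refine Subtype.ext (MultilinearMap.ext fun v => ?_)
    simp only [dMulti_apply, dFun, Submodule.coe_smul, _root_.smul_apply, smul_add,
      Finset.smul_sum, RingHom.id_apply, smul_comm _ c]

lemma d_apply (f : Cochain R A M k) (v : Fin (k + 1) → A) : (d R A M k f).1 v =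
    v 0 • f.1 (Fin.tail v) +
      ∑ i : Fin k, (-1 : ℤ) ^ ((i : ℕ) + 1) • f.1 (Fin.contractNth i.castSucc (· * ·) v) +
      (-1 : ℤ) ^ (k + 1) • op (v (Fin.last k)) • f.1 (Fin.init v) := rfl

lemma d_d (f : Cochain R A M k) : d R A M (k + 1) (d R A M k f) = 0 :=
  Subtype.ext (MultilinearMap.ext fun v => dFun_dFun f.1 v)

variable (R A M) in
/-- The Hochschild `k`-coboundaries: the image of the differential in positive degrees, and zero in
degree zero. -/
def coboundaries : (k : ℕ) → Submodule R (Cochain R A M k)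
  | 0 => ⊥
  | k + 1 => LinearMap.range (d R A M k)

end Hochschild

open CategoryTheory in
/-- The normalized Hochschild complex of the `A`-bimodule `M`. -/
def hochschildComplex (R : Type*) (A : Type*) (M : Type*) [CommRing R] [Ring A] [Algebra R A]
    [AddCommGroup M] [Module R M] [Module A M] [Module Aᵐᵒᵖ M] [IsScalarTower R A M]
    [IsScalarTower R Aᵐᵒᵖ M] [SMulCommClass A Aᵐᵒᵖ M] : CochainComplex (ModuleCat R) ℕ :=
  CochainComplex.of (fun k => ModuleCat.of R (Hochschild.Cochain R A M k))
    (fun k => ModuleCat.ofHom (Hochschild.d R A M k))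
    (fun _ => ModuleCat.hom_ext (LinearMap.ext Hochschild.d_d))

lemma hochschildComplex_d (R : Type*) (A : Type*) (M : Type*) [CommRing R] [Ring A] [Algebra R A]
    [AddCommGroup M] [Module R M] [Module A M] [Module Aᵐᵒᵖ M] [IsScalarTower R A M]
    [IsScalarTower R Aᵐᵒᵖ M] [SMulCommClass A Aᵐᵒᵖ M] (k : ℕ) :
    (hochschildComplex R A M).d k (k + 1) = ModuleCat.ofHom (Hochschild.d R A M k) :=
  CochainComplex.of_d (fun k => ModuleCat.of R (Hochschild.Cochain R A M k))
    (fun k => ModuleCat.ofHom (Hochschild.d R A M k)) k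

end

noncomputable section

namespace Koszul

open MulOpposite Weyl

variable {n : ℕ} {M : Type*} [AddCommGroup M] [Module ℂ M] [Module (Weyl n) M]
  [Module (Weyl n)ᵐᵒᵖ M] [IsScalarTower ℂ (Weyl n) M] [IsScalarTower ℂ (Weyl n)ᵐᵒᵖ M]
  [SMulCommClass (Weyl n) (Weyl n)ᵐᵒᵖ M] {k : ℕ}

variable (n M) in
/-- `ad X (m) = X m - m X`. -/
def ad (X : Weyl n) : M →ₗ[ℂ] M :=
  Algebra.lsmul ℂ ℂ M X - Algebra.lsmul ℂ ℂ M (op X)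

lemma ad_apply (X : Weyl n) (m : M) : ad n M X m = X • m - op X • m := rfl

variable (n M) in
/-- `ad X (m)` as a bilinear map. -/
def adLin : Weyl n →ₗ[ℂ] M →ₗ[ℂ] M where
  toFun := ad n M
  map_add' X Y := LinearMap.ext fun m => by
    simp only [ad_apply, LinearMap.add_apply, add_smul, op_add]; abel
  map_smul' c X := LinearMap.ext fun m => by
    simp only [ad_apply, LinearMap.smul_apply, op_smul, smul_assoc, smul_sub, RingHom.id_apply]

lemma algebraMap_op_smul (c : ℂ) (m : M) : op (algebraMap ℂ (Weyl n) c) • m = c • m := by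
  rw [Algebra.algebraMap_eq_smul_one, op_smul, smul_assoc, op_one, one_smul]

lemma ad_comm (v w : V n) (m : M) :
    ad n M v (ad n M w m) = ad n M w (ad n M v m) := by
  obtain ⟨c, hc⟩ := V_commutator v w
  have h1 : (v : Weyl n) * w = w * v + algebraMap ℂ (Weyl n) c := by rw [← hc]; abel
  simp only [ad_apply, smul_sub, smul_smul, ← op_mul, h1, add_smul, op_add,
    algebraMap_op_smul, algebraMap_smul]
  rw [smul_comm (v : Weyl n) (op (w : Weyl n)) m, smul_comm (w : Weyl n) (op (v : Weyl n)) m]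
  abel

variable (n M) in
/-- Alternating `k`-forms on `V` with values in `M`. -/
abbrev Form (k : ℕ) : Type _ := (V n) [⋀^Fin k]→ₗ[ℂ] M

/-- The exterior product `μ_φ(Ω) = φ ∧ Ω` of a linear form `φ` on `V` with `Ω`, i.e.
`(φ ∧ Ω)(v₀, …, vₖ) = ∑ᵢ (-1)ⁱ φ(vᵢ) Ω(v₀, …, v̂ᵢ, …, vₖ)`. -/
def wedge (φ : V n →ₗ[ℂ] ℂ) : Form n M k →ₗ[ℂ] Form n M (k + 1) :=
  AlternatingMap.alternatizeUncurryFinLM ∘ₗ LinearMap.smulRightₗ φ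

/-- `∑ᵢ ad Zᵢ ⊗ μ_{Zᵢ*}` on alternating forms. -/
def dForm : Form n M k →ₗ[ℂ] Form n M (k + 1) :=
  ∑ i : Fin n ⊕ Fin n,
    wedge (Zdual i) ∘ₗ LinearMap.compAlternatingMapₗ ℂ (ad n M (Z i))

lemma dForm_apply (c : Form n M k) (v : Fin (k + 1) → V n) :
    dForm c v = ∑ j : Fin (k + 1), (-1 : ℤ) ^ (j : ℕ) • ad n M (v j) (c (j.removeNth v)) := by
  have h : ∀ (w : V n) (m : M), ad n M w m = ∑ i, Zdual i w • ad n M (Z i) m := by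
    intro w m
    change adLin n M w m = _
    rw [← sum_Zdual w, map_sum, LinearMap.sum_apply]
    simp only [map_smul, LinearMap.smul_apply]
    rfl
  rw [dForm, LinearMap.sum_apply]
  change AlternatingMap.toMultilinearMapLM (S := ℂ) (∑ _, _) v = _
  rw [map_sum, _root_.sum_apply]
  simp only [h, Finset.smul_sum]
  rw [Finset.sum_comm]
  refine Finset.sum_congr rfl fun i _ => ?_
  rw [wedge, LinearMap.comp_apply, LinearMap.comp_apply,
    AlternatingMap.alternatizeUncurryFinLM_apply]
  exact AlternatingMap.alternatizeUncurryFin_apply _ _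

/-- `v ↦ ad v ∘ c` as a linear map. -/
def adForm (c : Form n M k) : V n →ₗ[ℂ] Form n M k where
  toFun v := (ad n M v).compAlternatingMap c
  map_add' v w := AlternatingMap.ext fun u =>
    LinearMap.congr_fun (map_add (adLin n M) (v : Weyl n) w) (c u)
  map_smul' a v := AlternatingMap.ext fun u =>
    LinearMap.congr_fun (map_smul (adLin n M) a (v : Weyl n)) (c u)

/-- `(v, w) ↦ ad v ∘ ad w ∘ c` as a bilinear map. -/
def adAdForm (c : Form n M k) : V n →ₗ[ℂ] V n →ₗ[ℂ] Form n M k where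
  toFun v := LinearMap.compAlternatingMapₗ ℂ (ad n M v) ∘ₗ adForm c
  map_add' v w := LinearMap.ext fun x => map_add (adForm (adForm c x)) v w
  map_smul' a v := LinearMap.ext fun x => map_smul (adForm (adForm c x)) a v

lemma dForm_eq (c : Form n M k) : dForm c = AlternatingMap.alternatizeUncurryFin (adForm c) :=
  AlternatingMap.ext fun v => by
    rw [dForm_apply, AlternatingMap.alternatizeUncurryFin_apply]; rfl

lemma dForm_dForm (c : Form n M k) : dForm (dForm c) = 0 := by
  rw [dForm_eq, ← AlternatingMap.alternatizeUncurryFin_alternatizeUncurryFinLM_comp_of_symmetric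
    (f := adAdForm c) fun x y => AlternatingMap.ext fun u => ad_comm x y (c u)]
  congr 1
  refine LinearMap.ext fun v => AlternatingMap.ext fun u => ?_
  change ad n M v (dForm c u) = AlternatingMap.alternatizeUncurryFin (adAdForm c v) u
  rw [dForm_apply, AlternatingMap.alternatizeUncurryFin_apply, map_sum]
  refine Finset.sum_congr rfl fun j _ => ?_
  rw [map_zsmul]
  rfl

variable (n M) in
/-- The Koszul cochains `Kᵏ(M) = L(Λᵏ, M)`. -/
abbrev Cochain (k : ℕ) : Type _ := ⋀[ℂ]^k (V n) →ₗ[ℂ] M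

variable (n M) in
/-- The Koszul differential `Δₖ = ∑ᵢ ad Zᵢ ⊗ μ_{Zᵢ*}`, where `L(Λᵏ, M)` is identified with the
space of alternating `k`-forms on `V` with values in `M`. -/
def Δ (k : ℕ) : Cochain n M k →ₗ[ℂ] Cochain n M (k + 1) :=
  exteriorPower.alternatingMapLinearEquiv.toLinearMap ∘ₗ dForm ∘ₗ
    exteriorPower.alternatingMapLinearEquiv.symm.toLinearMap

lemma Δ_equiv (c : Form n M k) : Δ n M k (exteriorPower.alternatingMapLinearEquiv c) =
    exteriorPower.alternatingMapLinearEquiv (dForm c) := by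
  simp [Δ]

lemma Δ_Δ (c : Cochain n M k) : Δ n M (k + 1) (Δ n M k c) = 0 := by
  simp [Δ, dForm_dForm]

/-- The value of the Koszul differential on decomposable elements. -/
lemma Δ_apply_ιMulti (c : Cochain n M k) (v : Fin (k + 1) → V n) :
    Δ n M k c (exteriorPower.ιMulti ℂ (k + 1) v) = ∑ j : Fin (k + 1), (-1 : ℤ) ^ (j : ℕ) •
      (((v j : Weyl n) • c (exteriorPower.ιMulti ℂ k (j.removeNth v))) -
        op (v j : Weyl n) • c (exteriorPower.ιMulti ℂ k (j.removeNth v))) := by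
  obtain ⟨c, rfl⟩ := exteriorPower.alternatingMapLinearEquiv.surjective c
  simp only [Δ_equiv, exteriorPower.alternatingMapLinearEquiv_apply_ιMulti, dForm_apply, ad_apply]

variable (n M) in
/-- The skew-symmetrization of the restriction of a normalized Hochschild cochain to `V`. -/
def restrictForm (k : ℕ) : Hochschild.Cochain ℂ (Weyl n) M k →ₗ[ℂ] Form n M k where
  toFun C := MultilinearMap.alternatization (C.1.compLinearMap fun _ => (V n).subtype)
  map_add' C C' := by
    rw [← map_add]; rfl
  map_smul' a C := AlternatingMap.ext fun v => by
    simp only [MultilinearMap.alternatization_apply, RingHom.id_apply, AlternatingMap.smul_apply,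
      Finset.smul_sum, smul_comm a]
    rfl

lemma restrictForm_apply (C : Hochschild.Cochain ℂ (Weyl n) M k) (v : Fin k → V n) :
    restrictForm n M k C v = ∑ σ : Equiv.Perm (Fin k),
      (Equiv.Perm.sign σ : ℤ) • C.1 (fun i => (v (σ i) : Weyl n)) := by
  change MultilinearMap.alternatization _ v = _
  rw [MultilinearMap.alternatization_apply]
  rfl

/-- Permutations of `{0, …, k}` as pairs of the image of `0` and a permutation of the rest. -/
lemma sum_perm_succ (g : Equiv.Perm (Fin (k + 1)) → M) :
    ∑ σ : Equiv.Perm (Fin (k + 1)), g σ = ∑ j : Fin (k + 1), ∑ τ : Equiv.Perm (Fin k),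
      g (j.cycleRange.symm * Equiv.Perm.decomposeFin.symm (0, τ)) := by
  rw [← Finset.sum_product', Finset.univ_product_univ]
  symm
  refine Function.Bijective.sum_comp (e := fun p : Fin (k + 1) × Equiv.Perm (Fin k) =>
    (p.1.cycleRange.symm * Equiv.Perm.decomposeFin.symm (0, p.2) : Equiv.Perm (Fin (k + 1)))) ?_ g
  rw [Fintype.bijective_iff_injective_and_card]
  constructor
  · rintro ⟨j, τ⟩ ⟨j', τ'⟩ h
    have h0 := congrArg (fun σ : Equiv.Perm (Fin (k + 1)) => σ 0) h
    simp only [Equiv.Perm.mul_apply, Equiv.Perm.decomposeFin_symm_apply_zero,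
      Fin.cycleRange_symm_zero] at h0
    subst h0
    have h1 := mul_left_cancel h
    simpa using h1
  · simp [Fintype.card_perm, Nat.factorial_succ]

lemma left_sum (B : V n → M →ₗ[ℂ] M) (C : Hochschild.Cochain ℂ (Weyl n) M k)
    (v : Fin (k + 1) → V n) :
    ∑ σ : Equiv.Perm (Fin (k + 1)), (Equiv.Perm.sign σ : ℤ) •
      B (v (σ 0)) (C.1 (fun i => (v (σ i.succ) : Weyl n))) =
    ∑ j : Fin (k + 1), (-1 : ℤ) ^ (j : ℕ) • B (v j) (restrictForm n M k C (j.removeNth v)) := by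
  rw [sum_perm_succ]
  refine Finset.sum_congr rfl fun j _ => ?_
  rw [restrictForm_apply, map_sum, Finset.smul_sum]
  refine Finset.sum_congr rfl fun τ _ => ?_
  rw [map_zsmul, smul_smul]
  simp only [Equiv.Perm.mul_apply, Equiv.Perm.decomposeFin_symm_apply_zero,
    Fin.cycleRange_symm_zero, Equiv.Perm.decomposeFin_symm_apply_succ, Equiv.swap_self,
    Equiv.refl_apply, Fin.cycleRange_symm_succ]
  have : ((Equiv.Perm.sign (j.cycleRange.symm * Equiv.Perm.decomposeFin.symm (0, τ)) : ℤˣ) : ℤ) =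
      (-1) ^ (j : ℕ) * (Equiv.Perm.sign τ : ℤ) := by
    rw [Equiv.Perm.sign_mul, Equiv.Perm.decomposeFin.symm_sign, Equiv.Perm.sign_symm,
      Fin.sign_cycleRange]
    simp
  rw [this]
  rfl

lemma right_sum (B : V n → M →ₗ[ℂ] M) (C : Hochschild.Cochain ℂ (Weyl n) M k)
    (v : Fin (k + 1) → V n) :
    ∑ σ : Equiv.Perm (Fin (k + 1)), (Equiv.Perm.sign σ : ℤ) • (-1 : ℤ) ^ (k + 1) •
      B (v (σ (Fin.last k))) (C.1 (fun i => (v (σ i.castSucc) : Weyl n))) =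
    -∑ j : Fin (k + 1), (-1 : ℤ) ^ (j : ℕ) • B (v j) (restrictForm n M k C (j.removeNth v)) := by
  rw [← left_sum, ← Finset.sum_neg_distrib,
    ← Equiv.sum_comp (Equiv.mulRight (finRotate (k + 1)))]
  refine Finset.sum_congr rfl fun σ _ => ?_
  have h1 : ∀ i : Fin k, finRotate (k + 1) i.castSucc = i.succ := fun i => by
    rw [finRotate_apply]; simp
  simp only [Equiv.coe_mulRight, Equiv.Perm.mul_apply, finRotate_last, h1]
  rw [smul_smul, ← neg_smul, Equiv.Perm.sign_mul, sign_finRotate]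
  congr 1
  have : ((-1 : ℤ) ^ k) * (-1) ^ k = 1 := by rw [← mul_pow]; simp
  push_cast
  rw [pow_succ]
  linear_combination (-(Equiv.Perm.sign σ : ℤ)) * this

lemma mid_sum (C : Hochschild.Cochain ℂ (Weyl n) M k) (v : Fin (k + 1) → V n) (i : Fin k) :
    ∑ σ : Equiv.Perm (Fin (k + 1)), (Equiv.Perm.sign σ : ℤ) •
      C.1 (Hochschild.contract i (fun l => (v (σ l) : Weyl n))) = 0 := by
  set S := ∑ σ : Equiv.Perm (Fin (k + 1)), (Equiv.Perm.sign σ : ℤ) •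
      C.1 (Hochschild.contract i (fun l => (v (σ l) : Weyl n))) with hS
  have h1 : S = -∑ σ : Equiv.Perm (Fin (k + 1)), (Equiv.Perm.sign σ : ℤ) •
      C.1 (Hochschild.contract i
        (fun l => (v (σ (Equiv.swap i.castSucc i.succ l)) : Weyl n))) := by
    rw [hS, ← Equiv.sum_comp (Equiv.mulRight (Equiv.swap i.castSucc i.succ)),
      ← Finset.sum_neg_distrib]
    refine Finset.sum_congr rfl fun σ _ => ?_
    rw [Equiv.coe_mulRight, Equiv.Perm.sign_mul,
      Equiv.Perm.sign_swap (by simp [Fin.ext_iff]), ← neg_smul]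
    simp
  have h2 : S + S = 0 := by
    nth_rewrite 2 [h1]
    rw [← sub_eq_add_neg, sub_eq_zero]
    refine Finset.sum_congr rfl fun σ _ => ?_
    congr 1
    set u : Fin (k + 1) → Weyl n := fun l => (v (σ l) : Weyl n)
    have e1 : Hochschild.contract i u =
        Function.update (Hochschild.contract i u) i (u i.castSucc * u i.succ) := by
      symm
      rw [Function.update_eq_self_iff]
      simp [Hochschild.contract_apply]
    have e2 : Hochschild.contract i (fun l => u (Equiv.swap i.castSucc i.succ l)) =
        Function.update (Hochschild.contract i u) i (u i.succ * u i.castSucc) := by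
      funext l
      rw [Function.update_apply]
      split_ifs with h
      · subst h
        simp [Hochschild.contract_apply]
      · have h' : (l : ℕ) ≠ i := fun h' => h (Fin.ext h')
        simp only [Hochschild.contract_apply]
        split_ifs with h4
        · rw [Equiv.swap_apply_of_ne_of_ne] <;> simp [Fin.ext_iff] <;> omega
        · rw [Equiv.swap_apply_of_ne_of_ne] <;> simp [Fin.ext_iff] <;> omega
    obtain ⟨c, hc⟩ := V_commutator (v (σ i.castSucc)) (v (σ i.succ))
    change C.1 (Hochschild.contract i u) =
      C.1 (Hochschild.contract i (fun l => u (Equiv.swap i.castSucc i.succ l)))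
    rw [e2, e1, ← sub_eq_zero, Function.update_idem, ← MultilinearMap.map_update_sub]
    exact C.2 _ ⟨i, c, by rw [Function.update_self]; exact hc.symm⟩
  have h3 : (2 : ℂ) • S = 0 := by rw [two_smul, h2]
  exact (smul_eq_zero.1 h3).resolve_left two_ne_zero

lemma restrictForm_d (C : Hochschild.Cochain ℂ (Weyl n) M k) :
    restrictForm n M (k + 1) (Hochschild.d ℂ (Weyl n) M k C) = dForm (restrictForm n M k C) := by
  refine AlternatingMap.ext fun v => ?_
  have hl := left_sum (fun w => Algebra.lsmul ℂ ℂ M (w : Weyl n)) C v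
  have hr := right_sum (fun w => Algebra.lsmul ℂ ℂ M (op (w : Weyl n))) C v
  rw [restrictForm_apply, dForm_apply]
  simp only [ad_apply, smul_sub, Finset.sum_sub_distrib]
  simp only [Algebra.lsmul_coe] at hl hr
  rw [sub_eq_add_neg, ← hl, ← hr]
  simp only [Hochschild.d_apply, smul_add, Finset.sum_add_distrib, Finset.smul_sum]
  rw [Finset.sum_comm]
  have hm : ∑ i : Fin k, ∑ σ : Equiv.Perm (Fin (k + 1)), (Equiv.Perm.sign σ : ℤ) •
      (-1 : ℤ) ^ ((i : ℕ) + 1) • C.1 (Fin.contractNth i.castSucc (· * ·)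
        (fun l => (v (σ l) : Weyl n))) = 0 := by
    refine Finset.sum_eq_zero fun i _ => ?_
    simp only [smul_comm _ ((-1 : ℤ) ^ _), ← Finset.smul_sum]
    rw [mid_sum, smul_zero]
  rw [hm, add_zero]
  rfl

variable (n M) in
/-- The restriction of normalized Hochschild cochains to `Λᵏ`, where `Λᵏ` is embedded in the `k`-th
tensor power by `v₁ ∧ … ∧ vₖ ↦ ∑_σ ε(σ) v_σ(1) ⊗ … ⊗ v_σ(k)`. -/
def restrict (k : ℕ) : Hochschild.Cochain ℂ (Weyl n) M k →ₗ[ℂ] Cochain n M k :=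
  exteriorPower.alternatingMapLinearEquiv.toLinearMap ∘ₗ restrictForm n M k

lemma restrict_apply_ιMulti (C : Hochschild.Cochain ℂ (Weyl n) M k) (v : Fin k → V n) :
    restrict n M k C (exteriorPower.ιMulti ℂ k v) = ∑ σ : Equiv.Perm (Fin k),
      (Equiv.Perm.sign σ : ℤ) • C.1 (fun i => (v (σ i) : Weyl n)) := by
  rw [← restrictForm_apply]
  exact exteriorPower.alternatingMapLinearEquiv_apply_ιMulti _ _

lemma restrict_d (C : Hochschild.Cochain ℂ (Weyl n) M k) :
    restrict n M (k + 1) (Hochschild.d ℂ (Weyl n) M k C) = Δ n M k (restrict n M k C) := by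
  rw [restrict, restrict, LinearMap.comp_apply, LinearMap.comp_apply, restrictForm_d]
  exact (Δ_equiv _).symm

end Koszul

section Complexes

open CategoryTheory

variable (n : ℕ) (M : Type*) [AddCommGroup M] [Module ℂ M] [Module (Weyl n) M]
  [Module (Weyl n)ᵐᵒᵖ M] [IsScalarTower ℂ (Weyl n) M] [IsScalarTower ℂ (Weyl n)ᵐᵒᵖ M]
  [SMulCommClass (Weyl n) (Weyl n)ᵐᵒᵖ M]

/-- The Koszul complex `K(M)` of the bimodule `M` over the Weyl algebra. -/
def koszulComplex : CochainComplex (ModuleCat ℂ) ℕ :=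
  CochainComplex.of (fun k => ModuleCat.of ℂ (Koszul.Cochain n M k))
    (fun k => ModuleCat.ofHom (Koszul.Δ n M k))
    (fun _ => ModuleCat.hom_ext (LinearMap.ext Koszul.Δ_Δ))

lemma koszulComplex_d (k : ℕ) :
    (koszulComplex n M).d k (k + 1) = ModuleCat.ofHom (Koszul.Δ n M k) :=
  CochainComplex.of_d (fun k => ModuleCat.of ℂ (Koszul.Cochain n M k))
    (fun k => ModuleCat.ofHom (Koszul.Δ n M k)) k

/-- The restriction map from the normalized Hochschild complex of `M` to the Koszul complex. -/
def restriction : hochschildComplex ℂ (Weyl n) M ⟶ koszulComplex n M :=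
  CochainComplex.ofHom (X := hochschildComplex ℂ (Weyl n) M) (Y := koszulComplex n M)
    (fun k => ModuleCat.ofHom (Koszul.restrict n M k))
    (fun k => by
      rw [koszulComplex_d, hochschildComplex_d]
      exact ModuleCat.hom_ext (LinearMap.ext fun C => (Koszul.restrict_d C).symm))

end Complexes

end

/-!
The restriction map `R` is surjective, because an alternating form on `V` extends to a normalized
cochain by means of the projection onto linear parts (`Koszul.restrictForm_surjective`). Everything
therefore follows from the acyclicity of its kernel `N(M)`
(`Koszul.exists_d_eq_of_restrictForm_eq_zero`), which is proved for all bimodules `M` at once by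
induction on the degree.

In degree zero `N(M)` vanishes, and a cocycle of degree one is a derivation that vanishes on `V`,
hence zero (`Koszul.eq_zero_of_restrictForm_one`). In higher degrees `M` is embedded into the
coinduced bimodule `Coind ℂ (Weyl n) M` of linear maps `f : W → M` with `(a f b)(x) = a f(b x)`. Both
complexes of this bimodule are exact in positive degrees, hence so is `N` above degree one, and the
class of a cocycle of `N(M)` comes from one of `N(Q)` in the preceding degree, where `Q` is the
quotient of the coinduced bimodule by `M`. Lifting cochains from `Q` requires only a linear section,
since `R` involves no more than the linear structure of the coefficients.

The Hochschild complex of the coinduced bimodule is contracted by inserting the argument of `f` as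
the last argument of the cochain (`Hochschild.d_coindHomotopy`). For its Koszul complex, let `h` be
the contraction `h c = ∑ₗ c(Zₗ, …) ∘ ∂ₗ`. Since `∂ₗ` is a derivation of the Moyal product, the
anticommutator of `h` with the differential acts on the coefficients of `m`-forms only, namely
through the operator taking `f` to
`x ↦ ∑ₗ Zₗ f(∂ₗ x) - f(∑ₗ Zₗ ∂ₗ x) - m f(x)` (`Koszul.dForm_contraction_add`). By Euler's identity,
which the Moyal product satisfies because its second order terms cancel in pairs, this operator is
triangular with respect to the degree of the monomials `x`, with diagonal entries `-(deg x + m)`. It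
is thus bijective for `m > 0`, which gives the exactness.
-/

noncomputable section

/-! ### Partial derivatives on the Weyl algebra -/

namespace Weyl

variable {n : ℕ}

/-- The partial derivative with respect to the generator `Z l`, on the Weyl algebra. -/
def partialDeriv (l : Fin n ⊕ Fin n) : Weyl n →ₗ[ℂ] Weyl n :=
  toPoly.symm.toLinearMap ∘ₗ dd l ∘ₗ toPoly.toLinearMap

/-- The generator conjugate to a given one: `pᵢ` and `qᵢ` are exchanged. -/
abbrev conj (l : Fin n ⊕ Fin n) : Fin n ⊕ Fin n := l.swap

/-- The sign of the Poisson bracket of a generator with its conjugate: `{pᵢ, qᵢ} = 1` and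
`{qᵢ, pᵢ} = -1`. -/
def bracketSign (l : Fin n ⊕ Fin n) : ℂ := l.elim (fun _ => 1) (fun _ => -1)

lemma dd_X (i j : Fin n ⊕ Fin n) :
    dd i (MvPolynomial.X j : Poly n) = (if j = i then (1 : ℂ) else 0) • (1 : Poly n) := by
  change MvPolynomial.pderiv i _ = _
  rw [MvPolynomial.pderiv_X, Pi.single_apply]
  split_ifs <;> simp_all

lemma poissonOp_X_tmul (i : Fin n ⊕ Fin n) (a : Poly n) :
    poissonOp n (MvPolynomial.X i ⊗ₜ a) = bracketSign i • (1 ⊗ₜ dd (conj i) a) := by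
  cases i <;>
  simp [poissonOp, biOp, LinearMap.sum_apply, d₁, d₂, dd_X, bracketSign, conj, ite_smul,
      TensorProduct.ite_tmul, TensorProduct.smul_tmul', TensorProduct.neg_tmul]

lemma moyal_X (i : Fin n ⊕ Fin n) (a : Poly n) :
    moyal n (MvPolynomial.X i) a =
      MvPolynomial.X i * a + ((1 / 2 : ℂ) * bracketSign i) • dd (conj i) a := by
  rw [moyal_eq_sum (N := 2)]
  · simp [Finset.sum_range_succ, poissonOp_X_tmul, smul_smul]
  · rw [pow_two, Module.End.mul_apply, poissonOp_X_tmul, map_smul]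
    simp [poissonOp, biOp, LinearMap.sum_apply, d₁, d₂, dd_one]

lemma Z_mul (i : Fin n ⊕ Fin n) (a : Weyl n) :
    Z i * a = toPoly.symm (MvPolynomial.X i * toPoly a) +
      ((1 / 2 : ℂ) * bracketSign i) • partialDeriv (conj i) a :=
  moyal_X i (toPoly a)

lemma partialDeriv_comm (i j : Fin n ⊕ Fin n) (a : Weyl n) :
    partialDeriv i (partialDeriv j a) = partialDeriv j (partialDeriv i a) :=
  LinearMap.congr_fun (dd_commute i j).eq (toPoly a)

lemma partialDeriv_Z_mul (l i : Fin n ⊕ Fin n) (a : Weyl n) :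
    partialDeriv l (Z i * a) =
      (if i = l then (1 : ℂ) else 0) • a + Z i * partialDeriv l a := by
  rw [Z_mul, Z_mul, map_add, map_smul, partialDeriv_comm l]
  have h (a : Poly n) : dd l (MvPolynomial.X i * a) =
      (if i = l then (1 : ℂ) else 0) • a + MvPolynomial.X i * dd l a := by
    rw [dd_mul, dd_X, smul_mul_assoc, one_mul]
  have h' : partialDeriv l (toPoly.symm (MvPolynomial.X i * toPoly a)) =
      (if i = l then (1 : ℂ) else 0) • a +
        toPoly.symm (MvPolynomial.X i * toPoly (partialDeriv l a)) :=
    congrArg toPoly.symm (h (toPoly a))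
  rw [h', add_assoc]

/-- The derivative in the direction `Z l` is a derivation of the Moyal product, at least for
products with a vector of `V`. -/
lemma partialDeriv_mul (l : Fin n ⊕ Fin n) (v : V n) (a : Weyl n) :
    partialDeriv l (v * a) = Zdual l v • a + v * partialDeriv l a := by
  rw [← sum_Zdual v]
  simp only [Finset.sum_mul, map_sum, smul_mul_assoc, map_smul, partialDeriv_Z_mul, smul_add,
    Finset.sum_add_distrib]
  congr 1
  simp

/-- A monomial, as an element of the Weyl algebra. -/
def mono (s : Fin n ⊕ Fin n →₀ ℕ) : Weyl n := toPoly.symm (MvPolynomial.monomial s 1)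

variable (n) in
/-- The basis of monomials. -/
def monoBasis : Module.Basis (Fin n ⊕ Fin n →₀ ℕ) ℂ (Weyl n) :=
  (MvPolynomial.basisMonomials (Fin n ⊕ Fin n) ℂ).map toPoly.symm

lemma monoBasis_apply (s : Fin n ⊕ Fin n →₀ ℕ) : monoBasis n s = mono s := by
  simp [monoBasis, mono]

lemma mono_zero : mono (0 : Fin n ⊕ Fin n →₀ ℕ) = 1 := rfl

lemma partialDeriv_mono (l : Fin n ⊕ Fin n) (s : Fin n ⊕ Fin n →₀ ℕ) :
    partialDeriv l (mono s) = (s l : ℂ) • mono (s - Finsupp.single l 1) := by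
  have h : dd l (MvPolynomial.monomial s 1 : Poly n) =
      (s l : ℂ) • (MvPolynomial.monomial (s - Finsupp.single l 1) 1 : Poly n) := by
    change MvPolynomial.pderiv l _ = _
    rw [MvPolynomial.pderiv_monomial, MvPolynomial.smul_monomial]
    simp
  exact congrArg toPoly.symm h

/-- Euler's identity. The second order terms of the Moyal products cancel in pairs of conjugate
generators, so that it holds for the Moyal product as for the commutative one. -/
lemma sum_Z_mul_partialDeriv_mono (s : Fin n ⊕ Fin n →₀ ℕ) :
    ∑ l, Z l * partialDeriv l (mono s) = (s.degree : ℂ) • mono s := by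
  have h2 : ∑ l : Fin n ⊕ Fin n, ((1 / 2 : ℂ) * bracketSign l) •
      partialDeriv (conj l) (partialDeriv l (mono s)) = 0 := by
    rw [Fintype.sum_sum_type, ← Finset.sum_add_distrib]
    refine Finset.sum_eq_zero fun i _ => ?_
    simp only [conj, Sum.swap_inl, Sum.swap_inr, bracketSign, Sum.elim_inl, Sum.elim_inr]
    rw [partialDeriv_comm (.inr i)]
    module
  simp only [Z_mul, Finset.sum_add_distrib, h2, add_zero]
  have h := (MvPolynomial.isHomogeneous_monomial (R := ℂ) 1 (rfl : s.degree = _)).sum_X_mul_pderiv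
  rw [← Nat.cast_smul_eq_nsmul ℂ] at h
  rw [← map_sum]
  exact congrArg toPoly.symm h

lemma degree_sub_single_lt {l : Fin n ⊕ Fin n} {s : Fin n ⊕ Fin n →₀ ℕ} (h : s l ≠ 0) :
    (s - Finsupp.single l 1).degree < s.degree := by
  have h1 : s - Finsupp.single l 1 + Finsupp.single l 1 = s :=
    tsub_add_cancel_of_le (Finsupp.single_le_iff.2 (Nat.one_le_iff_ne_zero.2 h))
  nth_rewrite 2 [← h1]
  simp

variable {M : Type*} [AddCommGroup M] [Module ℂ M]

/-- A linear map on the Weyl algebra vanishes if its value on each monomial is zero as soon as it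
is zero on the partial derivatives of the monomial. -/
lemma eq_zero_of_partialDeriv (f : Weyl n →ₗ[ℂ] M)
    (h : ∀ s, (∀ l, f (partialDeriv l (mono s)) = 0) → f (mono s) = 0) : f = 0 := by
  refine (monoBasis n).ext fun s => ?_
  rw [monoBasis_apply, LinearMap.zero_apply]
  induction hd : s.degree using Nat.strong_induction_on generalizing s with
  | _ d ih =>
    refine h s fun l => ?_
    rw [partialDeriv_mono, map_smul]
    by_cases hl : s l = 0
    · simp [hl]
    · rw [ih _ (hd ▸ degree_sub_single_lt hl) _ rfl, smul_zero]

end Weyl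

end

noncomputable section

open MulOpposite

/-! ### Coinduced bimodules and their quotients -/

section Coinduced

/-- The coinduced bimodule of a left module `M`: the space of `R`-linear maps `f : A → M`, with
the action `(a f b)(x) = a f(b x)`. It is a type synonym, because the right action differs from the
pointwise one. -/
def Coind (R A M : Type*) [CommRing R] [Ring A] [Algebra R A] [AddCommGroup M] [Module R M] :
    Type _ := A →ₗ[R] M

variable {R A M : Type*} [CommRing R] [Ring A] [Algebra R A] [AddCommGroup M] [Module R M]

namespace Coind

instance : AddCommGroup (Coind R A M) := inferInstanceAs (AddCommGroup (A →ₗ[R] M))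

instance : Module R (Coind R A M) := inferInstanceAs (Module R (A →ₗ[R] M))

/-- An element of the coinduced bimodule as a linear map. -/
def toLin : Coind R A M ≃ₗ[R] (A →ₗ[R] M) := LinearEquiv.refl R _

@[ext] lemma ext {f g : Coind R A M} (h : ∀ x, toLin f x = toLin g x) : f = g :=
  LinearMap.ext h

variable (R A M) in
/-- Evaluation at `1`, a left inverse of the embedding of `M` into its coinduced bimodule. -/
def eval : Coind R A M →ₗ[R] M := LinearMap.applyₗ 1 ∘ₗ toLin.toLinearMap

lemma eval_apply (f : Coind R A M) : eval R A M f = toLin f 1 := rfl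

variable [Module A M] [IsScalarTower R A M]

instance : Module A (Coind R A M) where
  smul a f := toLin.symm (Algebra.lsmul R R M a ∘ₗ toLin f)
  one_smul f := ext fun x => one_smul A (toLin f x)
  mul_smul a b f := ext fun x => mul_smul a b (toLin f x)
  smul_zero a := ext fun _ => smul_zero a
  smul_add a f g := ext fun x => smul_add a (toLin f x) (toLin g x)
  add_smul a b f := ext fun x => add_smul a b (toLin f x)
  zero_smul f := ext fun x => zero_smul A (toLin f x)

instance : Module Aᵐᵒᵖ (Coind R A M) where
  smul b f := toLin.symm (toLin f ∘ₗ LinearMap.mulLeft R (unop b))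
  one_smul f := ext fun x => congrArg (toLin f) (one_mul x)
  mul_smul a b f := ext fun x => congrArg (toLin f) (mul_assoc (unop b) (unop a) x)
  smul_zero a := rfl
  smul_add a f g := rfl
  add_smul a b f := ext fun x => by
    change toLin f ((unop a + unop b) * x) = toLin f (unop a * x) + toLin f (unop b * x)
    rw [add_mul, map_add]
  zero_smul f := ext fun x => by
    change toLin f (0 * x) = 0
    rw [zero_mul, map_zero]

@[simp] lemma toLin_smul (a : A) (f : Coind R A M) (x : A) :
    toLin (a • f) x = a • toLin f x := rfl

@[simp] lemma toLin_op_smul (b : A) (f : Coind R A M) (x : A) :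
    toLin (op b • f) x = toLin f (b * x) := rfl

instance : IsScalarTower R A (Coind R A M) :=
  ⟨fun r a f => ext fun _ => smul_assoc r a (toLin f _)⟩

instance : IsScalarTower R Aᵐᵒᵖ (Coind R A M) :=
  ⟨fun r b f => ext fun x => by
    change toLin f ((r • unop b) * x) = r • toLin f (unop b * x)
    rw [smul_mul_assoc, map_smul]⟩

instance : SMulCommClass A Aᵐᵒᵖ (Coind R A M) := ⟨fun _ _ _ => rfl⟩

end Coind

variable [Module A M] [Module Aᵐᵒᵖ M] [IsScalarTower R A M] [IsScalarTower R Aᵐᵒᵖ M]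
  [SMulCommClass A Aᵐᵒᵖ M]

variable (R A M) in
/-- The embedding of a bimodule `M` into its coinduced bimodule: `m ↦ (x ↦ m x)`. -/
def Coind.embed : M →ₗ[R] Coind R A M where
  toFun m := toLin.symm ((LinearMap.toSpanSingleton Aᵐᵒᵖ M m).restrictScalars R ∘ₗ
    (opLinearEquiv R).toLinearMap)
  map_add' m m' := ext fun x => smul_add (op x) m m'
  map_smul' r m := ext fun x => smul_comm (op x) r m

@[simp] lemma Coind.toLin_embed (m : M) (x : A) : toLin (embed R A M m) x = op x • m := rfl

lemma Coind.embed_smul (a : A) (m : M) : embed R A M (a • m) = a • embed R A M m :=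
  ext fun x => (smul_comm a (op x) m).symm

lemma Coind.embed_op_smul (b : A) (m : M) : embed R A M (op b • m) = op b • embed R A M m :=
  ext fun x => by simp [smul_smul]

lemma Coind.eval_embed (m : M) : eval R A M (embed R A M m) = m := by simp [eval_apply]

variable (R A M) in
/-- The quotient of the coinduced bimodule of `M` by `M`, realized as the space of linear maps
`A → M` that vanish at `1`. Along this identification the class of `f` corresponds to
`x ↦ f(x) - f(1) x`. -/
def CoindQuot : Type _ := LinearMap.ker (Coind.eval R A M)

namespace CoindQuot

instance : AddCommGroup (CoindQuot R A M) :=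
  inferInstanceAs (AddCommGroup (LinearMap.ker (Coind.eval R A M)))

instance : Module R (CoindQuot R A M) :=
  inferInstanceAs (Module R (LinearMap.ker (Coind.eval R A M)))

variable (R A M) in
/-- The inclusion of the maps vanishing at `1`, a linear section of `CoindQuot.proj` that is not
compatible with the right actions. -/
def incl : CoindQuot R A M →ₗ[R] Coind R A M := (LinearMap.ker (Coind.eval R A M)).subtype

lemma incl_injective : Function.Injective (incl R A M) := Subtype.val_injective

variable (R A M) in
/-- The projection from the coinduced bimodule of `M` to its quotient by `M`. -/
def proj : Coind R A M →ₗ[R] CoindQuot R A M :=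
  LinearMap.codRestrict (LinearMap.ker (Coind.eval R A M))
    (LinearMap.id - Coind.embed R A M ∘ₗ Coind.eval R A M) fun f => by
      simp [Coind.eval_embed]

lemma incl_proj (f : Coind R A M) :
    incl R A M (proj R A M f) = f - Coind.embed R A M (Coind.eval R A M f) := rfl

lemma eval_incl (f : CoindQuot R A M) : Coind.eval R A M (incl R A M f) = 0 := f.2

lemma proj_incl (f : CoindQuot R A M) : proj R A M (incl R A M f) = f :=
  incl_injective (by rw [incl_proj, eval_incl, map_zero, sub_zero])

lemma proj_embed (m : M) : proj R A M (Coind.embed R A M m) = 0 :=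
  incl_injective (by rw [incl_proj, Coind.eval_embed, sub_self, map_zero])

lemma proj_eq_zero {f : Coind R A M} (h : proj R A M f = 0) :
    Coind.embed R A M (Coind.eval R A M f) = f := by
  have := incl_proj f
  rwa [h, map_zero, eq_comm, sub_eq_zero, eq_comm] at this

instance : SMul A (CoindQuot R A M) := ⟨fun a f => proj R A M (a • incl R A M f)⟩

instance : SMul Aᵐᵒᵖ (CoindQuot R A M) := ⟨fun b f => proj R A M (b • incl R A M f)⟩

lemma proj_smul (a : A) (f : Coind R A M) : proj R A M (a • f) = a • proj R A M f := by
  change _ = proj R A M (a • incl R A M (proj R A M f))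
  rw [incl_proj, smul_sub, ← Coind.embed_smul, map_sub, proj_embed, sub_zero]

lemma proj_op_smul (b : Aᵐᵒᵖ) (f : Coind R A M) : proj R A M (b • f) = b • proj R A M f := by
  change _ = proj R A M (b • incl R A M (proj R A M f))
  rw [incl_proj, smul_sub, ← op_unop b, ← Coind.embed_op_smul, map_sub, proj_embed, sub_zero]

lemma proj_surjective : Function.Surjective (proj R A M) := fun f => ⟨_, proj_incl f⟩

instance : Module A (CoindQuot R A M) :=
  Function.Surjective.module A (proj R A M).toAddMonoidHom proj_surjective proj_smul

instance : Module Aᵐᵒᵖ (CoindQuot R A M) :=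
  Function.Surjective.module Aᵐᵒᵖ (proj R A M).toAddMonoidHom proj_surjective proj_op_smul

instance : IsScalarTower R A (CoindQuot R A M) := ⟨fun r a f => by
  obtain ⟨f, rfl⟩ := proj_surjective f
  rw [← proj_smul, ← proj_smul, smul_assoc, map_smul]⟩

instance : IsScalarTower R Aᵐᵒᵖ (CoindQuot R A M) := ⟨fun r b f => by
  obtain ⟨f, rfl⟩ := proj_surjective f
  rw [← proj_op_smul, ← proj_op_smul, smul_assoc, map_smul]⟩

instance : SMulCommClass A Aᵐᵒᵖ (CoindQuot R A M) := ⟨fun a b f => by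
  obtain ⟨f, rfl⟩ := proj_surjective f
  rw [← proj_op_smul, ← proj_smul, smul_comm, proj_op_smul, proj_smul]⟩

end CoindQuot

end Coinduced

/-! ### Hochschild cochains with values in a coinduced bimodule -/

namespace Hochschild

variable {R A : Type*} [CommRing R] [Ring A] [Algebra R A] {k : ℕ}

section Map

variable {M N : Type*} [AddCommGroup M] [Module R M]
  [Module A M] [Module Aᵐᵒᵖ M] [IsScalarTower R A M] [IsScalarTower R Aᵐᵒᵖ M]
  [SMulCommClass A Aᵐᵒᵖ M] [AddCommGroup N] [Module R N]
  [Module A N] [Module Aᵐᵒᵖ N] [IsScalarTower R A N] [IsScalarTower R Aᵐᵒᵖ N]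
  [SMulCommClass A Aᵐᵒᵖ N]

/-- Composition of normalized cochains with a linear map of coefficients, which is not assumed to
be compatible with the actions. -/
def Cochain.map (φ : M →ₗ[R] N) : Cochain R A M k →ₗ[R] Cochain R A N k where
  toFun C := ⟨φ.compMultilinearMap C.1, fun v hv => by
    rw [LinearMap.compMultilinearMap_apply, C.2 v hv, map_zero]⟩
  map_add' C D := Subtype.ext (MultilinearMap.ext fun v => map_add φ (C.1 v) (D.1 v))
  map_smul' r C := Subtype.ext (MultilinearMap.ext fun v => map_smul φ r (C.1 v))

lemma Cochain.map_apply (φ : M →ₗ[R] N) (C : Cochain R A M k) (v : Fin k → A) :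
    (Cochain.map φ C).1 v = φ (C.1 v) := rfl

lemma d_map (φ : M →ₗ[R] N) (hl : ∀ (a : A) m, φ (a • m) = a • φ m)
    (hr : ∀ (b : A) m, φ (op b • m) = op b • φ m) (C : Cochain R A M k) :
    d R A N k (Cochain.map φ C) = Cochain.map φ (d R A M k C) :=
  Subtype.ext (MultilinearMap.ext fun v => by
    simp only [d_apply, Cochain.map_apply, map_add, map_sum, map_zsmul, hl, hr])

end Map

variable {M : Type*} [AddCommGroup M] [Module R M] [Module A M] [IsScalarTower R A M]

/-- The cochain `(a₁, …, aₖ) ↦ (x ↦ C(a₁, …, aₖ, x)(1))`, which contracts, up to sign, the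
Hochschild complex of a coinduced bimodule in positive degrees. -/
def coindHomotopy (C : Cochain R A (Coind R A M) (k + 1)) : Cochain R A (Coind R A M) k :=
  ⟨((LinearMap.compRight R (Coind.eval R A M)).compMultilinearMap C.1.curryRight :
      MultilinearMap R (fun _ : Fin k => A) (A →ₗ[R] M)), fun v ⟨i, hi⟩ => Coind.ext fun x => by
    have h := C.2 (Fin.snoc v x) ⟨i.castSucc, by simpa using hi⟩
    exact congrArg (Coind.eval R A M) h⟩

lemma coindHomotopy_apply (C : Cochain R A (Coind R A M) (k + 1)) (v : Fin k → A) (x : A) :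
    Coind.toLin ((coindHomotopy C).1 v) x = Coind.toLin (C.1 (Fin.snoc v x)) 1 := rfl

lemma d_coindHomotopy (C : Cochain R A (Coind R A M) (k + 1))
    (hC : d R A (Coind R A M) (k + 1) C = 0) :
    d R A (Coind R A M) k (coindHomotopy C) = (-1 : ℤ) ^ (k + 1) • C := by
  refine Subtype.ext (MultilinearMap.ext fun v => Coind.ext fun x => ?_)
  have h : Coind.eval R A M ((d R A (Coind R A M) (k + 1) C).1
    (Fin.snoc v x : Fin (k + 2) → A)) = 0 := by rw [hC]; rfl
  have e0 : Fin.tail (Fin.snoc v x : Fin (k + 2) → A) = Fin.snoc (Fin.tail v) x := by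
    funext l
    refine Fin.lastCases ?_ (fun l => ?_) l
    · rw [Fin.snoc_last, Fin.tail, Fin.succ_last, Fin.snoc_last]
    · rw [Fin.snoc_castSucc, Fin.tail, Fin.succ_castSucc, Fin.snoc_castSucc]; rfl
  have e1 (i : Fin k) : contract i.castSucc (Fin.snoc v x : Fin (k + 2) → A) =
      Fin.snoc (contract i v) x := by
    funext l
    refine Fin.lastCases ?_ (fun l => ?_) l
    · have := i.2
      rw [contract_apply, Fin.snoc_last, if_neg (by simp), if_neg (by simp; omega),
        Fin.succ_last, Fin.snoc_last]
    · rw [contract_apply, Fin.snoc_castSucc, Fin.succ_castSucc, Fin.snoc_castSucc,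
        Fin.snoc_castSucc]; rfl
  have e2 : contract (Fin.last k) (Fin.snoc v x : Fin (k + 2) → A) =
      Fin.snoc (Fin.init v) (v (Fin.last k) * x) := by
    funext l
    refine Fin.lastCases ?_ (fun l => ?_) l
    · rw [contract_apply, Fin.snoc_last, if_neg (by simp), if_pos rfl, Fin.snoc_castSucc,
        Fin.succ_last, Fin.snoc_last]
    · rw [contract_apply, Fin.snoc_castSucc, if_pos (by simp), Fin.snoc_castSucc]; rfl
  have e3 : (Fin.snoc v x : Fin (k + 2) → A) 0 = v 0 := Fin.snoc_castSucc (i := 0) ..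
  rw [d_apply, Fin.sum_univ_castSucc] at h
  rw [d_apply]
  simp only [e0, e3, Fin.init_snoc, Fin.snoc_last] at h
  simp only [e1, e2, map_add, map_sum, map_zsmul, Coind.eval_apply, Coind.toLin_smul,
    Coind.toLin_op_smul, mul_one, Fin.val_castSucc, Fin.val_last] at h
  simp only [map_add, map_sum, map_zsmul, LinearMap.add_apply, LinearMap.sum_apply,
    LinearMap.smul_apply, Coind.toLin_smul, Coind.toLin_op_smul, coindHomotopy_apply]
  change _ = Coind.toLin ((-1 : ℤ) ^ (k + 1) • C.1 v) x
  rw [map_zsmul, LinearMap.smul_apply]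
  rw [pow_succ _ (k + 1), mul_neg_one, neg_smul, add_neg_eq_zero, ← add_assoc] at h
  exact h

lemma exists_d_eq_of_coind (C : Cochain R A (Coind R A M) (k + 1))
    (hC : d R A (Coind R A M) (k + 1) C = 0) : ∃ D, d R A (Coind R A M) k D = C := by
  refine ⟨(-1 : ℤ) ^ (k + 1) • coindHomotopy C, ?_⟩
  rw [map_zsmul, d_coindHomotopy C hC, smul_smul, ← mul_pow]
  simp

end Hochschild
end

noncomputable section

/-! ### Koszul cochains with values in a coinduced bimodule -/

namespace Koszul

open MulOpposite Weyl

variable {n : ℕ} {M : Type*} [AddCommGroup M] [Module ℂ M] [Module (Weyl n) M]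
  [IsScalarTower ℂ (Weyl n) M] {k : ℕ}

lemma form_sum_apply {N ι : Type*} [AddCommGroup N] [Module ℂ N] (s : Finset ι)
    (f : ι → Form n N k) (v : Fin k → V n) : (∑ i ∈ s, f i) v = ∑ i ∈ s, f i v :=
  map_sum (AddMonoidHom.mk' (fun f : Form n N k => f v) fun _ _ => rfl) f s

/-- Precomposition with a partial derivative, on the coinduced bimodule. -/
def coindDeriv (l : Fin n ⊕ Fin n) : Module.End ℂ (Coind ℂ (Weyl n) M) :=
  LinearMap.lcomp ℂ M (partialDeriv l)

@[simp] lemma toLin_coindDeriv (l : Fin n ⊕ Fin n) (f : Coind ℂ (Weyl n) M) (x : Weyl n) :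
    Coind.toLin (coindDeriv l f) x = Coind.toLin f (partialDeriv l x) := rfl

lemma ad_coindDeriv (l : Fin n ⊕ Fin n) (v : V n) (f : Coind ℂ (Weyl n) M) :
    ad n _ (v : Weyl n) (coindDeriv l f) =
      coindDeriv l (ad n _ (v : Weyl n) f) - Zdual l v • f := by
  refine Coind.ext fun x => ?_
  simp [ad_apply, partialDeriv_mul]
  abel

/-- The contraction `(h c)(v₁, …, vₖ) = ∑ₗ c(Zₗ, v₁, …, vₖ) ∘ ∂ₗ`, dual to the de Rham
differential of polynomial forms. -/
def contraction (c : Form n (Coind ℂ (Weyl n) M) (k + 1)) : Form n (Coind ℂ (Weyl n) M) k :=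
  ∑ l, (coindDeriv l).compAlternatingMap (c.curryLeft (ZV l))

lemma contraction_apply (c : Form n (Coind ℂ (Weyl n) M) (k + 1)) (v : Fin k → V n) :
    contraction c v = ∑ l, coindDeriv l (c (Fin.cons (ZV l) v)) := by
  rw [contraction, form_sum_apply]
  rfl

lemma contraction_zero : contraction (0 : Form n (Coind ℂ (Weyl n) M) (k + 1)) = 0 := by
  simp [contraction]

variable (n M) in
/-- The Laplacian `∑ₗ ∂ₗ ∘ ad Zₗ - m` of the coinduced bimodule, through which the anticommutator
of the Koszul differential and the contraction acts on `m`-forms. -/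
def laplacian (m : ℕ) : Module.End ℂ (Coind ℂ (Weyl n) M) :=
  ∑ l, coindDeriv l * ad n _ (Z l) - (m : ℂ) • 1

lemma dForm_contraction_add (c : Form n (Coind ℂ (Weyl n) M) (k + 1)) :
    dForm (contraction c) + contraction (dForm c) =
      (laplacian n M (k + 1)).compAlternatingMap c := by
  refine AlternatingMap.ext fun v => ?_
  have e (l) (j : Fin (k + 1)) : j.succ.removeNth (Fin.cons (ZV l) v : Fin (k + 2) → V n) =
      Fin.cons (ZV l) (j.removeNth v) :=
    Fin.cons_comp_succ_succAbove _ _ _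
  have hd (l) : dForm c (Fin.cons (ZV l) v : Fin (k + 2) → V n) = ad n _ (Z l) (c v) +
      ∑ j : Fin (k + 1), (-1 : ℤ) ^ ((j : ℕ) + 1) •
        ad n _ (v j : Weyl n) (c (Fin.cons (ZV l) (j.removeNth v))) := by
    rw [dForm_apply, Fin.sum_univ_succ]
    simp only [e, Fin.cons_zero, Fin.cons_succ, Fin.removeNth_zero, Fin.tail_cons, Fin.val_zero,
      pow_zero, one_smul, Fin.val_succ]
    rfl
  have hZ (j : Fin (k + 1)) : ∑ l, Zdual l (v j) • c (Fin.cons (ZV l) (j.removeNth v)) =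
      (-1 : ℤ) ^ (j : ℕ) • c v := by
    have h : ∑ l, Zdual l (v j) • ZV l = v j := Subtype.ext (by
      rw [← sum_Zdual (v j), AddSubmonoidClass.coe_finsetSum]; rfl)
    have h' := congrArg (fun w => c.curryLeft w (j.removeNth v)) h
    simp only [map_sum, map_smul, form_sum_apply] at h'
    refine h'.trans ?_
    rw [AlternatingMap.curryLeft_apply_apply, ← AlternatingMap.neg_one_pow_smul_map_insertNth c j,
      Fin.insertNth_self_removeNth]
  change dForm (contraction c) v + contraction (dForm c) v = laplacian n M (k + 1) (c v)
  rw [dForm_apply, contraction_apply]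
  simp only [contraction_apply, hd, map_sum, ad_coindDeriv, Finset.sum_sub_distrib, hZ,
    map_add, map_zsmul, Finset.sum_add_distrib, smul_sub, smul_smul, ← pow_add, pow_succ]
  rw [Finset.sum_comm]
  have h2 (j : ℕ) : (-1 : ℤ) ^ (j + j) = 1 := Even.neg_one_pow ⟨j, rfl⟩
  simp only [h2, Finset.smul_sum, one_smul, Finset.sum_const, Finset.card_univ, Fintype.card_fin,
    mul_neg_one, neg_smul, Finset.sum_neg_distrib]
  simp only [laplacian, LinearMap.sub_apply, LinearMap.sum_apply, LinearMap.smul_apply,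
    Module.End.mul_apply, Module.End.one_apply, Nat.cast_smul_eq_nsmul]
  abel

lemma toLin_laplacian_mono (m : ℕ) (f : Coind ℂ (Weyl n) M) (s : Fin n ⊕ Fin n →₀ ℕ) :
    Coind.toLin (laplacian n M m f) (mono s) =
      ∑ l, Z l • Coind.toLin f (partialDeriv l (mono s)) -
        ((s.degree + m : ℕ) : ℂ) • Coind.toLin f (mono s) := by
  simp only [laplacian, LinearMap.sub_apply, LinearMap.sum_apply, map_sub, map_sum,
    Module.End.mul_apply, LinearMap.smul_apply, Module.End.one_apply, map_smul, toLin_coindDeriv,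
    ad_apply, Coind.toLin_smul, Coind.toLin_op_smul, Finset.sum_sub_distrib, Nat.cast_add]
  rw [← map_sum, sum_Z_mul_partialDeriv_mono, map_smul]
  module

lemma laplacian_injective {m : ℕ} (hm : m ≠ 0) : Function.Injective (laplacian n M m) := by
  rw [injective_iff_map_eq_zero]
  refine fun f hf => Coind.toLin.map_eq_zero_iff.1 (eq_zero_of_partialDeriv _ fun s hs => ?_)
  have h := toLin_laplacian_mono m f s
  simp only [hf, hs, smul_zero, Finset.sum_const_zero, zero_sub, map_zero, LinearMap.zero_apply,
    zero_eq_neg] at h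
  exact (smul_eq_zero.1 h).resolve_left (Nat.cast_ne_zero.2 (by omega))

/-- The values on monomials of the preimage of a map under the Laplacian, found by recursion on the
degree by solving the identity `toLin_laplacian_mono`. The case distinction makes the recursion
well founded: the term for `l` vanishes if `Z l` does not occur in the monomial. -/
def laplacianInv (m : ℕ) (g : Coind ℂ (Weyl n) M) (s : Fin n ⊕ Fin n →₀ ℕ) : M :=
  ((s.degree + m : ℕ) : ℂ)⁻¹ • (∑ l, (if h : s l = 0 then 0 else
    (s l : ℂ) • Z l • laplacianInv m g (s - Finsupp.single l 1)) - Coind.toLin g (mono s))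
termination_by s.degree
decreasing_by exact degree_sub_single_lt h

lemma laplacian_surjective {m : ℕ} (hm : m ≠ 0) : Function.Surjective (laplacian n M m) := by
  intro g
  set f : Coind ℂ (Weyl n) M := Coind.toLin.symm ((monoBasis n).constr ℂ (laplacianInv m g))
  have hf (s) : Coind.toLin f (mono s) = laplacianInv m g s := by
    rw [← monoBasis_apply]
    exact (monoBasis n).constr_basis ℂ _ s
  refine ⟨f, Coind.toLin.injective ((monoBasis n).ext fun s => ?_)⟩
  rw [monoBasis_apply, toLin_laplacian_mono, hf, laplacianInv, smul_smul,
    mul_inv_cancel₀ (Nat.cast_ne_zero.2 (by omega)), one_smul, sub_sub_eq_add_sub, add_comm,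
    add_sub_assoc, add_eq_left, sub_eq_zero]
  refine Finset.sum_congr rfl fun l _ => ?_
  rw [partialDeriv_mono, map_smul, hf]
  split_ifs with h
  · simp [h]
  · rw [smul_comm]

/-- The Koszul complex of a coinduced bimodule is exact in positive degrees. -/
lemma exists_dForm_eq_of_coind (c : Form n (Coind ℂ (Weyl n) M) (k + 1)) (hc : dForm c = 0) :
    ∃ b, dForm b = c := by
  set e := LinearEquiv.ofBijective (laplacian n M (k + 1))
    ⟨laplacian_injective k.succ_ne_zero, laplacian_surjective k.succ_ne_zero⟩
  set u := e.symm.toLinearMap.compAlternatingMap c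
  have hu : (laplacian n M (k + 1)).compAlternatingMap u = c :=
    AlternatingMap.ext fun v => e.apply_symm_apply (c v)
  have hdu : dForm u = 0 := by
    have h1 := dForm_contraction_add u
    have h2 := dForm_contraction_add (dForm u)
    rw [dForm_dForm] at h2
    have h3 : dForm (contraction (dForm u)) = 0 := by
      have := congrArg dForm h1
      rwa [map_add, dForm_dForm, zero_add, hu, hc] at this
    rw [h3, zero_add] at h2
    refine AlternatingMap.ext fun v => laplacian_injective (k + 1).succ_ne_zero ?_
    have h4 := DFunLike.congr_fun h2.symm v
    rw [contraction_zero] at h4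
    rw [AlternatingMap.zero_apply, map_zero]
    exact h4
  refine ⟨contraction u, ?_⟩
  have h := dForm_contraction_add u
  rwa [hu, hdu, contraction_zero, add_zero] at h

end Koszul
end

noncomputable section

/-! ### The kernel of the restriction map -/

namespace Koszul

open MulOpposite Weyl

section Restriction

variable {n : ℕ} {M N : Type*} [AddCommGroup M] [Module ℂ M] [Module (Weyl n) M]
  [Module (Weyl n)ᵐᵒᵖ M] [IsScalarTower ℂ (Weyl n) M] [IsScalarTower ℂ (Weyl n)ᵐᵒᵖ M]
  [SMulCommClass (Weyl n) (Weyl n)ᵐᵒᵖ M] [AddCommGroup N] [Module ℂ N] [Module (Weyl n) N]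
  [Module (Weyl n)ᵐᵒᵖ N] [IsScalarTower ℂ (Weyl n) N] [IsScalarTower ℂ (Weyl n)ᵐᵒᵖ N]
  [SMulCommClass (Weyl n) (Weyl n)ᵐᵒᵖ N] {k : ℕ}

lemma restrictForm_map (φ : M →ₗ[ℂ] N) (C : Hochschild.Cochain ℂ (Weyl n) M k) :
    restrictForm n N k (Hochschild.Cochain.map φ C) =
      φ.compAlternatingMap (restrictForm n M k C) :=
  AlternatingMap.ext fun v => by
    simp only [restrictForm_apply, LinearMap.compAlternatingMap_apply, map_sum, map_zsmul,
      Hochschild.Cochain.map_apply]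

variable (n) in
/-- The projection of the Weyl algebra onto `V` that takes the linear part of a polynomial. -/
def linearPart : Weyl n →ₗ[ℂ] V n :=
  ∑ l, (MvPolynomial.lcoeff ℂ (Finsupp.single l 1) ∘ₗ toPoly.toLinearMap).smulRight (ZV l)

lemma linearPart_coe (v : V n) : linearPart n v = v :=
  Subtype.ext (by
    nth_rewrite 2 [← sum_Zdual v]
    rw [linearPart, LinearMap.sum_apply, AddSubmonoidClass.coe_finsetSum]
    rfl)

lemma linearPart_one : linearPart n 1 = 0 := by
  rw [linearPart, LinearMap.sum_apply]
  refine Finset.sum_eq_zero fun l _ => ?_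
  have h : MvPolynomial.coeff (Finsupp.single l 1) (1 : Poly n) = 0 := by
    rw [MvPolynomial.coeff_one, if_neg (Finsupp.single_ne_zero.2 one_ne_zero).symm]
  change MvPolynomial.coeff (Finsupp.single l 1) (1 : Poly n) • ZV l = 0
  rw [h, zero_smul]

lemma restrictForm_surjective : Function.Surjective (restrictForm n M k) := by
  intro c
  let C : MultilinearMap ℂ (fun _ : Fin k => Weyl n) M :=
    c.toMultilinearMap.compLinearMap fun _ => linearPart n
  have hC : C ∈ Hochschild.Cochain ℂ (Weyl n) M k := by
    rw [Hochschild.mem_cochain_iff_one]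
    rintro v ⟨i, hi⟩
    exact c.map_coord_zero i (by rw [hi, linearPart_one])
  refine ⟨(k.factorial : ℂ)⁻¹ • ⟨C, hC⟩, ?_⟩
  have h : restrictForm n M k ⟨C, hC⟩ = (k.factorial : ℂ) • c := by
    refine AlternatingMap.ext fun v => ?_
    have h1 (σ : Equiv.Perm (Fin k)) : (Equiv.Perm.sign σ : ℤ) • C (fun i => (v (σ i) : Weyl n)) =
        c v := by
      have h2 : C (fun i => (v (σ i) : Weyl n)) = c (v ∘ σ) :=
        congrArg c (funext fun i => linearPart_coe _)
      rw [h2, c.map_perm, Units.smul_def, smul_smul, ← Units.val_mul, Int.units_mul_self,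
        Units.val_one, one_smul]
    rw [restrictForm_apply]
    simp only [h1, Finset.sum_const, Finset.card_univ, Fintype.card_perm, Fintype.card_fin,
      ← Nat.cast_smul_eq_nsmul ℂ]
    rfl
  rw [map_smul, h, smul_smul, inv_mul_cancel₀ (Nat.cast_ne_zero.2 k.factorial_ne_zero), one_smul]

lemma restrictForm_zero_injective : Function.Injective (restrictForm n M 0) := by
  rw [injective_iff_map_eq_zero]
  refine fun C hC => Subtype.ext (MultilinearMap.ext fun v => ?_)
  have h := DFunLike.congr_fun hC Fin.elim0
  rw [restrictForm_apply, Fintype.sum_unique] at h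
  rw [Equiv.Perm.default_eq, Equiv.Perm.sign_one, Units.val_one, one_smul] at h
  exact (congrArg C.1 (Subsingleton.elim _ _)).trans h

/-- A derivation of the Weyl algebra that vanishes on `V` is zero. On a monomial `x` of degree `m`
this follows from Euler's identity `∑ₗ Zₗ ∂ₗx = m x` by induction on `m`. -/
lemma eq_zero_of_restrictForm_one (C : Hochschild.Cochain ℂ (Weyl n) M 1)
    (hd : Hochschild.d ℂ (Weyl n) M 1 C = 0) (hC : restrictForm n M 1 C = 0) : C = 0 := by
  let f : Weyl n →ₗ[ℂ] M := C.1.toLinearMap 0 0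
  have hf (v : Fin 1 → Weyl n) : C.1 v = f (v 0) :=
    congrArg C.1 (funext fun i => by rw [Subsingleton.elim i 0, Function.update_self])
  have hV (l) : f (Z l) = 0 := by
    have h := DFunLike.congr_fun hC fun _ => ZV l
    rw [restrictForm_apply, Fintype.sum_unique, hf, Equiv.Perm.default_eq,
      Equiv.Perm.sign_one, Units.val_one, one_smul] at h
    exact h
  have hmul (a b : Weyl n) : f (a * b) = a • f b + op b • f a := by
    have h : (Hochschild.d ℂ (Weyl n) M 1 C).1 ![a, b] = 0 := by rw [hd]; rfl
    rw [Hochschild.d_apply] at h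
    simp [hf, Fin.init, Fin.contractNth] at h
    rw [← sub_eq_zero, ← neg_eq_zero, ← h]
    abel
  have h1 : f 1 = 0 := by
    have := hmul 1 1
    simpa using this
  have hf0 : f = 0 := by
    refine eq_zero_of_partialDeriv f fun s hs => ?_
    by_cases h0 : s = 0
    · rw [h0, mono_zero, h1]
    have h := congrArg f (sum_Z_mul_partialDeriv_mono s)
    simp only [map_sum, hmul, hs, hV, smul_zero, add_zero, Finset.sum_const_zero, map_smul] at h
    exact (smul_eq_zero.1 h.symm).resolve_left
      (Nat.cast_ne_zero.2 fun h => h0 ((Finsupp.degree_eq_zero_iff s).1 h))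
  exact Subtype.ext (MultilinearMap.ext fun v => by rw [hf, hf0]; rfl)

/-- The coinduced bimodule has no cohomology in positive degrees, neither in the Hochschild complex
nor in the Koszul complex, so that the kernel of the restriction map has none above degree one. -/
lemma exists_d_eq_of_restrictForm_eq_zero_of_coind
    (C : Hochschild.Cochain ℂ (Weyl n) (Coind ℂ (Weyl n) M) (k + 2))
    (hd : Hochschild.d ℂ (Weyl n) _ (k + 2) C = 0) (hC : restrictForm n _ (k + 2) C = 0) :
    ∃ D, Hochschild.d ℂ (Weyl n) _ (k + 1) D = C ∧ restrictForm n _ (k + 1) D = 0 := by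
  obtain ⟨B, rfl⟩ := Hochschild.exists_d_eq_of_coind C hd
  rw [restrictForm_d] at hC
  obtain ⟨b, hb⟩ := exists_dForm_eq_of_coind _ hC
  obtain ⟨B', rfl⟩ := restrictForm_surjective b
  refine ⟨B - Hochschild.d ℂ (Weyl n) _ k B', ?_, ?_⟩
  · rw [map_sub, Hochschild.d_d, sub_zero]
  · rw [map_sub, restrictForm_d, hb, sub_self]

end Restriction

universe u

/-- The kernel of the restriction map is acyclic, by dimension shifting along the embedding of `M`
into its coinduced bimodule. -/
theorem exists_d_eq_of_restrictForm_eq_zero {n : ℕ} (k : ℕ) (M : Type u) [AddCommGroup M]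
    [Module ℂ M] [Module (Weyl n) M] [Module (Weyl n)ᵐᵒᵖ M] [IsScalarTower ℂ (Weyl n) M]
    [IsScalarTower ℂ (Weyl n)ᵐᵒᵖ M] [SMulCommClass (Weyl n) (Weyl n)ᵐᵒᵖ M]
    (C : Hochschild.Cochain ℂ (Weyl n) M (k + 1))
    (hd : Hochschild.d ℂ (Weyl n) M (k + 1) C = 0) (hC : restrictForm n M (k + 1) C = 0) :
    ∃ D, Hochschild.d ℂ (Weyl n) M k D = C ∧ restrictForm n M k D = 0 := by
  induction k generalizing M with
  | zero => exact ⟨0, by rw [eq_zero_of_restrictForm_one C hd hC, map_zero], map_zero _⟩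
  | succ k ih =>
    let ι := Coind.embed ℂ (Weyl n) M
    let π := CoindQuot.proj ℂ (Weyl n) M
    let s := CoindQuot.incl ℂ (Weyl n) M
    have dι {j} (B : Hochschild.Cochain ℂ (Weyl n) M j) := Hochschild.d_map ι
      (fun a m => Coind.embed_smul a m) (fun b m => Coind.embed_op_smul b m) B
    have dπ {j} (B : Hochschild.Cochain ℂ (Weyl n) (Coind ℂ (Weyl n) M) j) := Hochschild.d_map π
      (fun a f => CoindQuot.proj_smul a f) (fun b f => CoindQuot.proj_op_smul (op b) f) B
    have hzero {P Q : Type u} [AddCommGroup P] [Module ℂ P] [AddCommGroup Q] [Module ℂ Q] {j : ℕ}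
        (φ : P →ₗ[ℂ] Q) : φ.compAlternatingMap (0 : Form n P j) = 0 :=
      AlternatingMap.ext fun _ => map_zero φ
    obtain ⟨D, hdD, hD⟩ := exists_d_eq_of_restrictForm_eq_zero_of_coind
      (Hochschild.Cochain.map ι C) (by rw [dι, hd, map_zero])
      (by rw [restrictForm_map, hC, hzero])
    obtain ⟨E, hdE, hE⟩ := ih _ (Hochschild.Cochain.map π D)
      (by
        rw [dπ, hdD]
        exact Subtype.ext (MultilinearMap.ext fun v => CoindQuot.proj_embed (C.1 v)))
      (by rw [restrictForm_map, hD, hzero])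
    let D' := D - Hochschild.d ℂ (Weyl n) _ k (Hochschild.Cochain.map s E)
    have hD' : restrictForm n _ (k + 1) D' = 0 := by
      rw [map_sub, hD, restrictForm_d, restrictForm_map, hE, hzero, map_zero, sub_zero]
    have hπ : Hochschild.Cochain.map π D' = 0 := by
      have hs : Hochschild.Cochain.map π (Hochschild.Cochain.map s E) = E :=
        Subtype.ext (MultilinearMap.ext fun v => CoindQuot.proj_incl (E.1 v))
      rw [map_sub, ← dπ, hs, hdE, sub_self]
    let F := Hochschild.Cochain.map (Coind.eval ℂ (Weyl n) M) D'
    have hF : Hochschild.Cochain.map ι F = D' :=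
      Subtype.ext (MultilinearMap.ext fun v => CoindQuot.proj_eq_zero
        (congrArg (fun G : Hochschild.Cochain ℂ (Weyl n) (CoindQuot ℂ (Weyl n) M) _ => G.1 v) hπ))
    refine ⟨F, ?_, by rw [restrictForm_map, hD', hzero]⟩
    have hι : Hochschild.Cochain.map ι (Hochschild.d ℂ (Weyl n) M (k + 1) F) =
        Hochschild.Cochain.map ι C := by
      rw [← dι, hF, map_sub, Hochschild.d_d, sub_zero, hdD]
    refine Subtype.ext (MultilinearMap.ext fun v => ?_)
    have h := congrArg (fun G : Hochschild.Cochain ℂ (Weyl n) (Coind ℂ (Weyl n) M) _ =>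
      Coind.eval ℂ (Weyl n) M (G.1 v)) hι
    simpa only [Hochschild.Cochain.map_apply, ι, Coind.eval_embed] using h

variable {n : ℕ} {M : Type*} [AddCommGroup M] [Module ℂ M] [Module (Weyl n) M]
  [Module (Weyl n)ᵐᵒᵖ M] [IsScalarTower ℂ (Weyl n) M] [IsScalarTower ℂ (Weyl n)ᵐᵒᵖ M]
  [SMulCommClass (Weyl n) (Weyl n)ᵐᵒᵖ M] {k : ℕ}

lemma restrict_eq_zero_iff {C : Hochschild.Cochain ℂ (Weyl n) M k} :
    restrict n M k C = 0 ↔ restrictForm n M k C = 0 :=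
  exteriorPower.alternatingMapLinearEquiv.map_eq_zero_iff

lemma restrict_surjective : Function.Surjective (restrict n M k) :=
  exteriorPower.alternatingMapLinearEquiv.surjective.comp restrictForm_surjective

/-- Two Hochschild cocycles with the same restriction are cohomologous. -/
lemma mem_coboundaries_of_restrict_eq_zero (C : Hochschild.Cochain ℂ (Weyl n) M k)
    (hd : Hochschild.d ℂ (Weyl n) M k C = 0) (hC : restrict n M k C = 0) :
    C ∈ Hochschild.coboundaries ℂ (Weyl n) M k := by
  rw [restrict_eq_zero_iff] at hC
  cases k with
  | zero => exact restrictForm_zero_injective (hC.trans (map_zero _).symm)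
  | succ k =>
    obtain ⟨D, hD, -⟩ := exists_d_eq_of_restrictForm_eq_zero k M C hd hC
    exact ⟨D, hD⟩

/-- Every Koszul cocycle is the restriction of a Hochschild cocycle. -/
lemma exists_cocycle_restrict_eq (c : Cochain n M k) (hc : Δ n M k c = 0) :
    ∃ C : Hochschild.Cochain ℂ (Weyl n) M k,
      Hochschild.d ℂ (Weyl n) M k C = 0 ∧ restrict n M k C = c := by
  obtain ⟨C, rfl⟩ := restrict_surjective c
  rw [← restrict_d, restrict_eq_zero_iff] at hc
  obtain ⟨D, hD, hD0⟩ := exists_d_eq_of_restrictForm_eq_zero k M _ (Hochschild.d_d C) hc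
  refine ⟨C - D, by rw [map_sub, hD, sub_self], ?_⟩
  rw [map_sub, restrict_eq_zero_iff.2 hD0, sub_zero]

lemma exists_d_eq_of_restrict_eq_Δ (C : Hochschild.Cochain ℂ (Weyl n) M (k + 1))
    (hd : Hochschild.d ℂ (Weyl n) M (k + 1) C = 0) (b : Cochain n M k)
    (hb : restrict n M (k + 1) C = Δ n M k b) : ∃ B, Hochschild.d ℂ (Weyl n) M k B = C := by
  obtain ⟨B, rfl⟩ := restrict_surjective b
  obtain ⟨D, hD⟩ := mem_coboundaries_of_restrict_eq_zero (C - Hochschild.d ℂ (Weyl n) M k B)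
    (by rw [map_sub, hd, Hochschild.d_d, sub_zero]) (by rw [map_sub, restrict_d, hb, sub_self])
  exact ⟨D + B, by rw [map_add, hD, sub_add_cancel]⟩

end Koszul

/-! ### The restriction map as a quasi-isomorphism -/

section Complexes

open CategoryTheory

variable {K : Type*} [Field K]

lemma LinearMap.exists_comp_eq_of_forall_mem_range {A X Y : Type*} [AddCommGroup A] [Module K A]
    [AddCommGroup X] [Module K X] [AddCommGroup Y] [Module K Y] (f : A →ₗ[K] Y) (g : X →ₗ[K] Y)
    (h : ∀ a, ∃ x, g x = f a) : ∃ e : A →ₗ[K] X, g ∘ₗ e = f := by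
  obtain ⟨e, he⟩ := Module.projective_lifting_property g.rangeRestrict
    (f.codRestrict (LinearMap.range g) h) g.surjective_rangeRestrict
  exact ⟨e, LinearMap.ext fun a => congrArg Subtype.val (LinearMap.congr_fun he a)⟩

/-- A morphism of cochain complexes of vector spaces is a quasi-isomorphism if every cocycle of the
target is the image of a cocycle, and a cocycle whose image is a coboundary is one itself. -/
lemma quasiIso_of_forall_cocycle {X Y : CochainComplex (ModuleCat K) ℕ} (φ : X ⟶ Y)
    (hsurj : ∀ k (c : Y.X k), Y.d k (k + 1) c = 0 → ∃ C, X.d k (k + 1) C = 0 ∧ φ.f k C = c)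
    (hinj : ∀ k (C : X.X k), X.d k (k + 1) C = 0 →
      (∃ b, Y.d ((ComplexShape.up ℕ).prev k) k b = φ.f k C) →
      ∃ B, X.d ((ComplexShape.up ℕ).prev k) k B = C) : QuasiIso φ := by
  refine ⟨fun k => ?_⟩
  rw [quasiIsoAt_iff_isIso_homologyMap]
  have hm : Mono (HomologicalComplex.homologyMap φ k) := by
    rw [HomologicalComplex.mono_homologyMap_iff_up_to_refinements φ _ k (k + 1) rfl (by simp)]
    intro A x hx y hy
    obtain ⟨e, he⟩ := LinearMap.exists_comp_eq_of_forall_mem_range x.hom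
      (X.d ((ComplexShape.up ℕ).prev k) k).hom fun a => hinj k (x a)
        (LinearMap.congr_fun (congrArg ModuleCat.Hom.hom hx) a)
        ⟨y a, (LinearMap.congr_fun (congrArg ModuleCat.Hom.hom hy) a).symm⟩
    exact ⟨A, 𝟙 A, inferInstance, ModuleCat.ofHom e, ModuleCat.hom_ext (by simpa using he.symm)⟩
  have he : Epi (HomologicalComplex.homologyMap φ k) := by
    rw [HomologicalComplex.epi_homologyMap_iff_up_to_refinements φ _ k (k + 1) rfl (by simp)]
    intro A y hy
    obtain ⟨e, he⟩ := LinearMap.exists_comp_eq_of_forall_mem_range y.hom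
      ((φ.f k).hom ∘ₗ (LinearMap.ker (X.d k (k + 1)).hom).subtype) fun a => by
        obtain ⟨C, hC, h⟩ := hsurj k (y a) (LinearMap.congr_fun (congrArg ModuleCat.Hom.hom hy) a)
        exact ⟨⟨C, hC⟩, h⟩
    refine ⟨A, 𝟙 A, inferInstance,
      ModuleCat.ofHom ((LinearMap.ker (X.d k (k + 1)).hom).subtype ∘ₗ e),
      ModuleCat.hom_ext (LinearMap.ext fun a => (e a).2), 0, ModuleCat.hom_ext ?_⟩
    simpa [LinearMap.comp_assoc] using he.symm
  exact isIso_of_mono_of_epi _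

variable (n : ℕ) (M : Type*) [AddCommGroup M] [Module ℂ M] [Module (Weyl n) M]
  [Module (Weyl n)ᵐᵒᵖ M] [IsScalarTower ℂ (Weyl n) M] [IsScalarTower ℂ (Weyl n)ᵐᵒᵖ M]
  [SMulCommClass (Weyl n) (Weyl n)ᵐᵒᵖ M]

lemma quasiIso_restriction : QuasiIso (restriction n M) := by
  refine quasiIso_of_forall_cocycle _ (fun k c hc => ?_) fun k C hC hb => ?_
  · rw [koszulComplex_d] at hc
    obtain ⟨C, hC, h⟩ := Koszul.exists_cocycle_restrict_eq c hc
    exact ⟨C, by rw [hochschildComplex_d]; exact hC, h⟩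
  · rw [hochschildComplex_d] at hC
    obtain ⟨b, hb⟩ := hb
    cases k with
    | zero =>
      have hp : ¬ (ComplexShape.up ℕ).Rel ((ComplexShape.up ℕ).prev 0) 0 := by simp
      rw [HomologicalComplex.shape _ _ _ hp] at hb
      have h := Koszul.mem_coboundaries_of_restrict_eq_zero C hC hb.symm
      exact ⟨0, (map_zero _).trans h.symm⟩
    | succ k =>
      have hp : (ComplexShape.up ℕ).prev (k + 1) = k := by simp
      generalize (ComplexShape.up ℕ).prev (k + 1) = j at hp b
      subst hp
      rw [koszulComplex_d] at hb
      rw [hochschildComplex_d]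
      exact Koszul.exists_d_eq_of_restrict_eq_Δ C hC b hb.symm

end Complexes

end

/-- For every bimodule `M` over the Weyl algebra, restriction to the exterior algebra of `V` is a
morphism from the normalized Hochschild complex to the Koszul complex that induces isomorphisms in
cohomology; every Koszul cocycle is the restriction of a Hochschild cocycle, and two such cocycles
differ by a Hochschild coboundary. -/
theorem theorem1 (n : ℕ) (M : Type*) [AddCommGroup M] [Module ℂ M] [Module (Weyl n) M]
    [Module (Weyl n)ᵐᵒᵖ M] [IsScalarTower ℂ (Weyl n) M] [IsScalarTower ℂ (Weyl n)ᵐᵒᵖ M]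
    [SMulCommClass (Weyl n) (Weyl n)ᵐᵒᵖ M] :
    QuasiIso (restriction n M) ∧
    ∀ (k : ℕ) (c : Koszul.Cochain n M k), Koszul.Δ n M k c = 0 →
      (∃ C : Hochschild.Cochain ℂ (Weyl n) M k,
        Hochschild.d ℂ (Weyl n) M k C = 0 ∧ Koszul.restrict n M k C = c) ∧
      ∀ C C' : Hochschild.Cochain ℂ (Weyl n) M k,
        Hochschild.d ℂ (Weyl n) M k C = 0 → Koszul.restrict n M k C = c →
        Hochschild.d ℂ (Weyl n) M k C' = 0 → Koszul.restrict n M k C' = c →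
        C - C' ∈ Hochschild.coboundaries ℂ (Weyl n) M k :=
  ⟨quasiIso_restriction n M, fun _ c hc => ⟨Koszul.exists_cocycle_restrict_eq c hc,
    fun C C' hC hR hC' hR' => Koszul.mem_coboundaries_of_restrict_eq_zero (C - C')
      (by rw [map_sub, hC, hC', sub_zero]) (by rw [map_sub, hR, hR', sub_self])⟩⟩
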